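/- **Setting.** Let $d\in\{2,3\}$, let $\Omega\subset\mathbb R^d$ be a bounded domain and let $\mathcal T$ be a finite face-to-face decomposition of $\Omega$ into closed $d$-simplices, $\overline\Omega=\bigcup_{K\in\mathcal T}K$, with set of $(d-1)$-dimensional faces $\mathcal F$. On $\mathbb R^{d\times d}$ let $P:Q$ be the Frobenius product and $|\cdot|$ the Frobenius norm. Let $\phi$ be a uniformly convex N-function, $\phi\in C^2((0,\infty))$, with indices $$1<r^-=\inf_{t>0}\frac{\phi''(t)t}{\phi'(t)}+1\le\sup_{t>0}\frac{\phi''(t)t}{\phi'(t)}+1=r^+<\infty ,$$ and let $\phi^*(t)=\sup_{s\ge0}(st-\phi(s))$. Let $\boldsymbol A\in C^0(\mathbb R^{d\times d},\mathbb R^{d\times d})\cap C^1(\mathbb R^{d\times d}\setminus\{0\},\mathbb R^{d\times d})$ with $\boldsymbol A(0)=0$ have $\phi$-structure with constants $C_0,C_1>0$: for all $P$, all $Q\ne0$ and all $i,j,k,l$, $$\sum_{i,j,k,l}\partial_{kl}A_{ij}(Q)P_{ij}P_{kl}\ge C_0\,\phi''(|Q|)|P|^2,\qquad |\partial_{kl}A_{ij}(Q)|\le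 C_1\,\phi''(|Q|).$$ Put $\boldsymbol F(Q)=\sqrt{\phi'(|Q|)|Q|}\,Q/|Q|$ (with $\boldsymbol F(0)=0$) and $\mathrm D v=\frac12(\nabla v+(\nabla v)^T)$. Let $W^{1,\phi}_0(\Omega)$ be the space of $\mathbb R^d$-valued Sobolev-Orlicz functions with zero boundary values, with norm $\|\nabla\cdot\|_\phi$ (Luxemburg norm), $W^{-1,\phi^*}(\Omega)$ its dual, and $L_0^{\phi^*}(\Omega)$ the space of scalar functions in $L^{\phi^*}(\Omega)$ with integral zero. Let $\mathbf{CR}$ be the space of element-wise affine $\mathbb R^d$-valued functions $v_h$ with $\int_F[v_h]=0$ for all $F\in\mathcal F$, where $[v_h]$ is the jump across an interior face and the trace on a boundary face; let $\widehat S^0_0$ be the space of element-wise constant scalar functions with integral zero over $\Omega$, let $\operatorname{div}_h$ be the element-wise divergence and $\mathbf Z_h=\{v_h\in\mathbf{CR}:\operatorname{div}_hv_h=0\}$. Let $\boldsymbol E:\mathbf{CR}\to W^{1,\infty}_0(\Omega)$ be a linear divergence-preserving smoothing operator: in each element, $\boldsymbol Ev_h=\mathcal Av_h+\mathcal Bv_h+\mathcal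 Cv_h$, where $\mathcal Av_h$ is the continuous piecewise affine function whose value at a vertex in $\Omega$ is a fixed convex combination of the values there of $v_h$ from the adjacent elements, and whose value at a vertex on $\partial\Omega$ is $0$; $\mathcal Bv_h$ is the combination of the face bubbles (the products of the $d$ barycentric coordinates of the vertices of a face) that has the same face integrals as $v_h-\mathcal Av_h$; and, on each $K\in\mathcal T$, $\mathcal Cv_h$ is an element bubble, that is, a continuous field on $K$ that vanishes on $\partial K$ and is polynomial on each simplex of the barycentric refinement of $K$, such that $\operatorname{div}\mathcal Cv_h=\operatorname{div}v_h-\operatorname{div}(\mathcal Av_h+\mathcal Bv_h)$ in each simplex of that refinement. **Theorem.** For given $r^\pm$, $C_0$, $C_1$ there is a constant $c$ depending only on them such that the following holds in every such setting. Let $f\in W^{-1,\phi^*}(\Omega)$ and let $(u,p)\in W^{1,\phi}_0(\Omega)\times L^{\phi^*}_0(\Omega)$ satisfy $$\int_\Omega\boldsymbol A(\mathrm Du):\mathrm Dv-\int_\Omega p\operatorname{div}v=\langle f,v\rangle\quad\forall v\in W^{1,\phi}_0(\Omega),\qquad \int_\Omega q\operatorname{div}u=0\quad\forall q\in L^{\phi^*}_0(\Omega).$$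 Let $(u_h,p_h)\in\mathbf{CR}\times\widehat S^0_0$ satisfy $$\int_\Omega\boldsymbol A(\mathrm D\boldsymbol Eu_h):\mathrm D\boldsymbol Ev_h-\int_\Omega p_h\operatorname{div}_hv_h=\langle f,\boldsymbol Ev_h\rangle\quad\forall v_h\in\mathbf{CR},\qquad \int_\Omega q_h\operatorname{div}_hu_h=0\quad\forall q_h\in\widehat S^0_0.$$ Then $$\|\boldsymbol F(\mathrm Du)-\boldsymbol F(\mathrm D\boldsymbol Eu_h)\|_{L^2(\Omega)}\le c\,\inf_{v_h\in\mathbf Z_h}\|\boldsymbol F(\mathrm Du)-\boldsymbol F(\mathrm D\boldsymbol Ev_h)\|_{L^2(\Omega)} .$$ -/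

import Mathlib

open MeasureTheory Set Filter Topology
open scoped ENNReal NNReal ContDiff

noncomputable section

namespace NonlinearStokes

/-- `ℝ^d` with the Euclidean norm. -/
abbrev Vec (d : ℕ) := EuclideanSpace ℝ (Fin d)

/-- `ℝ^{d×d}` with the Frobenius product as `inner ℝ` and the Frobenius norm as `‖·‖`;
the `(i,j)` entry of `Q` is `Q (i, j)`. -/
abbrev Mat (d : ℕ) := EuclideanSpace ℝ (Fin d × Fin d)

/-- The `j`-th unit vector. -/
def unitVec {d : ℕ} (j : Fin d) : Vec d := EuclideanSpace.single j 1

/-- The matrix whose only nonzero entry is a `1` at position `(k, l)`. -/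
def unitMat {d : ℕ} (k l : Fin d) : Mat d := EuclideanSpace.single (k, l) 1

/-- The symmetric part `(Q + Qᵀ) / 2`. -/
def symPart {d : ℕ} (Q : Mat d) : Mat d :=
  WithLp.toLp 2 fun p => (Q (p.1, p.2) + Q (p.2, p.1)) / 2

/-- The trace of a matrix. -/
def tr {d : ℕ} (Q : Mat d) : ℝ := ∑ i, Q (i, i)

/-! ### N-functions -/

/-- N-functions; only the values on `[0, ∞)` matter. -/
structure IsNFunction (φ : ℝ → ℝ) : Prop where
  continuousOn : ContinuousOn φ (Ici 0)
  convexOn : ConvexOn ℝ (Ici 0) φ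
  strictMonoOn : StrictMonoOn φ (Ici 0)
  map_zero : φ 0 = 0
  tendsto_zero : Tendsto (fun t => φ t / t) (𝓝[>] 0) (𝓝 0)
  tendsto_atTop : Tendsto (fun t => φ t / t) atTop atTop

/-- `φ` is a uniformly convex N-function, twice continuously differentiable on `(0, ∞)`, whose
indices of uniform convexity are exactly `rm` (the infimum) and `rp` (the supremum). -/
structure IsUniformlyConvexNFunction (φ : ℝ → ℝ) (rm rp : ℝ) : Prop where
  isNFunction : IsNFunction φ
  contDiffOn : ContDiffOn ℝ 2 φ (Ioi 0)
  one_lt : 1 < rm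
  isGLB : IsGLB ((fun t => deriv (deriv φ) t * t / deriv φ t + 1) '' Ioi 0) rm
  isLUB : IsLUB ((fun t => deriv (deriv φ) t * t / deriv φ t + 1) '' Ioi 0) rp

/-- The conjugate N-function `φ^*(t) = sup_{s ≥ 0} (s t - φ(s))`. -/
def conjugate (φ : ℝ → ℝ) (t : ℝ) : ℝ := sSup ((fun s => s * t - φ s) '' Ici 0)

/-! ### The nonlinear operator and the natural distance -/

/-- `A` has `φ`-structure with constants `C₀` and `C₁`. -/
structure HasPhiStructure {d : ℕ} (φ : ℝ → ℝ) (C₀ C₁ : ℝ) (A : Mat d → Mat d) : Prop where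
  continuous : Continuous A
  contDiffOn : ContDiffOn ℝ 1 A {0}ᶜ
  map_zero : A 0 = 0
  C₀_pos : 0 < C₀
  C₁_pos : 0 < C₁
  coercive : ∀ P Q : Mat d, Q ≠ 0 →
    C₀ * deriv (deriv φ) ‖Q‖ * ‖P‖ ^ 2 ≤
      ∑ i, ∑ j, ∑ k, ∑ l, fderiv ℝ A Q (unitMat k l) (i, j) * P (i, j) * P (k, l)
  bounded : ∀ Q : Mat d, Q ≠ 0 → ∀ i j k l,
    |fderiv ℝ A Q (unitMat k l) (i, j)| ≤ C₁ * deriv (deriv φ) ‖Q‖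

/-- `F(Q) = √(φ'(|Q|) |Q|) Q / |Q|`, with `F(0) = 0`. -/
def natF {d : ℕ} (φ : ℝ → ℝ) (Q : Mat d) : Mat d :=
  (√(deriv φ ‖Q‖ * ‖Q‖) / ‖Q‖) • Q

/-! ### Function spaces

Functions on `Ω` are represented by functions on the whole space whose values outside `Ω` are
irrelevant. -/

/-- `g ∈ L^φ(Ω)`. -/
def MemLPhi {d : ℕ} {X : Type*} [NormedAddCommGroup X] (φ : ℝ → ℝ) (Ω : Set (Vec d))
    (g : Vec d → X) : Prop :=
  AEStronglyMeasurable g (volume.restrict Ω) ∧ ∫⁻ x in Ω, ENNReal.ofReal (φ ‖g x‖) < ⊤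

/-- The Luxemburg norm `‖g‖_φ` on `Ω`. -/
def luxNorm {d : ℕ} {X : Type*} [NormedAddCommGroup X] (φ : ℝ → ℝ) (Ω : Set (Vec d))
    (g : Vec d → X) : ℝ :=
  sInf {s : ℝ | 0 < s ∧ ∫⁻ x in Ω, ENNReal.ofReal (φ (‖g x‖ / s)) ≤ 1}

/-- `q ∈ L^φ_0(Ω)`: scalar functions in `L^φ(Ω)` with integral zero. -/
def MemLPhiZeroMean {d : ℕ} (φ : ℝ → ℝ) (Ω : Set (Vec d)) (q : Vec d → ℝ) : Prop :=
  MemLPhi φ Ω q ∧ ∫ x in Ω, q x = 0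

/-- Smooth functions with compact support in `Ω`. -/
def IsTest {d : ℕ} {X : Type*} [NormedAddCommGroup X] [NormedSpace ℝ X] (Ω : Set (Vec d))
    (ψ : Vec d → X) : Prop :=
  ContDiff ℝ ∞ ψ ∧ HasCompactSupport ψ ∧ tsupport ψ ⊆ Ω

/-- The classical gradient `(∂_j v_i)_{ij}`. -/
def grad {d : ℕ} (v : Vec d → Vec d) (x : Vec d) : Mat d :=
  WithLp.toLp 2 fun p => fderiv ℝ v x (unitVec p.2) p.1

/-- `G` is a weak gradient of the vector field `v` in `Ω`. -/
def HasWeakGrad {d : ℕ} (Ω : Set (Vec d)) (v : Vec d → Vec d) (G : Vec d → Mat d) : Prop :=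
  LocallyIntegrableOn v Ω ∧ LocallyIntegrableOn G Ω ∧
    ∀ ψ : Vec d → ℝ, IsTest Ω ψ → ∀ i j : Fin d,
      ∫ x in Ω, v x i * fderiv ℝ ψ x (unitVec j) = -∫ x in Ω, G x (i, j) * ψ x

open scoped Classical in
/-- The weak gradient `∇v` in `Ω` (unique almost everywhere in an open set `Ω`). -/
def weakGrad {d : ℕ} (Ω : Set (Vec d)) (v : Vec d → Vec d) : Vec d → Mat d :=
  if h : ∃ G, HasWeakGrad Ω v G then h.choose else 0

/-- The symmetric gradient `Dv = (∇v + (∇v)ᵀ) / 2` in `Ω`. -/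
def symGrad {d : ℕ} (Ω : Set (Vec d)) (v : Vec d → Vec d) (x : Vec d) : Mat d :=
  symPart (weakGrad Ω v x)

/-- The divergence of `v` in `Ω`. -/
def weakDiv {d : ℕ} (Ω : Set (Vec d)) (v : Vec d → Vec d) (x : Vec d) : ℝ :=
  tr (weakGrad Ω v x)

/-- Zero boundary values: `v`, with weak gradient `G`, is a limit in `W^{1,1}(Ω)` of test fields,
that is, `v ∈ W^{1,1}_0(Ω)`. -/
def HasZeroTrace {d : ℕ} (Ω : Set (Vec d)) (v : Vec d → Vec d) (G : Vec d → Mat d) : Prop :=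
  ∀ ε : ℝ≥0∞, 0 < ε → ∃ ψ : Vec d → Vec d, IsTest Ω ψ ∧
    eLpNorm (fun x => v x - ψ x) 1 (volume.restrict Ω) +
      eLpNorm (fun x => G x - grad ψ x) 1 (volume.restrict Ω) < ε

/-- The vector-valued space `W^{1,φ}_0(Ω)`. -/
def W01Phi {d : ℕ} (φ : ℝ → ℝ) (Ω : Set (Vec d)) : Set (Vec d → Vec d) :=
  {v | ∃ G, HasWeakGrad Ω v G ∧ MemLPhi φ Ω v ∧ MemLPhi φ Ω G ∧ HasZeroTrace Ω v G}

theorem IsTest.add {d : ℕ} {X : Type*} [NormedAddCommGroup X] [NormedSpace ℝ X] {Ω : Set (Vec d)}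
    {ψ χ : Vec d → X} (hψ : IsTest Ω ψ) (hχ : IsTest Ω χ) : IsTest Ω (ψ + χ) :=
  ⟨hψ.1.add hχ.1, hψ.2.1.add hχ.2.1,
    (tsupport_add ψ χ).trans (union_subset hψ.2.2 hχ.2.2)⟩

theorem IsTest.const_smul {d : ℕ} {X : Type*} [NormedAddCommGroup X] [NormedSpace ℝ X]
    {Ω : Set (Vec d)} {ψ : Vec d → X} (hψ : IsTest Ω ψ) (a : ℝ) : IsTest Ω (a • ψ) :=
  ⟨hψ.1.const_smul a, hψ.2.1.mono fun x hx => by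
      simp only [Function.mem_support, Pi.smul_apply] at hx ⊢
      exact fun h => hx (by simp [h]),
    (closure_mono fun x hx => by
      simp only [Function.mem_support, Pi.smul_apply] at hx ⊢
      exact fun h => hx (by simp [h])).trans hψ.2.2⟩

theorem integrableOn_mul_test {d : ℕ} {Ω : Set (Vec d)} {ι : Type*} [Fintype ι]
    {g : Vec d → EuclideanSpace ℝ ι} (hg : LocallyIntegrableOn g Ω) {χ : Vec d → ℝ}
    (hχ : Continuous χ) (hc : HasCompactSupport χ) (hs : tsupport χ ⊆ Ω) (i : ι) :
    IntegrableOn (fun x => g x i * χ x) Ω := by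
  have h₁ : IntegrableOn g (tsupport χ) := hg.integrableOn_compact_subset hs hc
  have h₂ : IntegrableOn (fun x => g x i) (tsupport χ) :=
    (EuclideanSpace.proj (𝕜 := ℝ) i : EuclideanSpace ℝ ι →L[ℝ] ℝ).integrable_comp h₁
  have h₃ : IntegrableOn (fun x => g x i * χ x) (tsupport χ) :=
    h₂.mul_continuousOn hχ.continuousOn hc
  have h₄ : Function.support (fun x => g x i * χ x) ⊆ tsupport χ := fun x hx =>
    subset_tsupport _ fun h => hx (by simp [h])
  exact ((integrableOn_iff_integrable_of_support_subset h₄).1 h₃).integrableOn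

theorem integrableOn_mul_test_deriv {d : ℕ} {Ω : Set (Vec d)} {ι : Type*} [Fintype ι]
    {g : Vec d → EuclideanSpace ℝ ι} (hg : LocallyIntegrableOn g Ω) {ψ : Vec d → ℝ}
    (hψ : IsTest Ω ψ) (i : ι) (j : Fin d) :
    IntegrableOn (fun x => g x i * fderiv ℝ ψ x (unitVec j)) Ω :=
  integrableOn_mul_test hg ((hψ.1.continuous_fderiv (by simp)).clm_apply continuous_const)
    (hψ.2.1.fderiv_apply ℝ _) ((tsupport_fderiv_apply_subset ℝ _).trans hψ.2.2) i

theorem HasWeakGrad.add {d : ℕ} {Ω : Set (Vec d)} {v w : Vec d → Vec d} {G H : Vec d → Mat d}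
    (hv : HasWeakGrad Ω v G) (hw : HasWeakGrad Ω w H) : HasWeakGrad Ω (v + w) (G + H) := by
  refine ⟨hv.1.add hw.1, hv.2.1.add hw.2.1, fun ψ hψ i j => ?_⟩
  simp only [Pi.add_apply, PiLp.add_apply, add_mul]
  rw [integral_add (integrableOn_mul_test_deriv hv.1 hψ i j)
      (integrableOn_mul_test_deriv hw.1 hψ i j),
    integral_add (integrableOn_mul_test hv.2.1 hψ.1.continuous hψ.2.1 hψ.2.2 (i, j))
      (integrableOn_mul_test hw.2.1 hψ.1.continuous hψ.2.1 hψ.2.2 (i, j)),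
    hv.2.2 ψ hψ i j, hw.2.2 ψ hψ i j, neg_add]

theorem HasWeakGrad.const_smul {d : ℕ} {Ω : Set (Vec d)} {v : Vec d → Vec d} {G : Vec d → Mat d}
    (hv : HasWeakGrad Ω v G) (a : ℝ) : HasWeakGrad Ω (a • v) (a • G) := by
  refine ⟨hv.1.smul a, hv.2.1.smul a, fun ψ hψ i j => ?_⟩
  simp only [Pi.smul_apply, PiLp.smul_apply, smul_eq_mul, mul_assoc]
  rw [integral_const_mul, integral_const_mul, hv.2.2 ψ hψ i j, mul_neg]

theorem grad_add {d : ℕ} {v w : Vec d → Vec d} (hv : Differentiable ℝ v)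
    (hw : Differentiable ℝ w) : grad (v + w) = grad v + grad w := by
  funext x
  ext p
  simp [grad, fderiv_add (hv x) (hw x)]

theorem grad_const_smul {d : ℕ} {v : Vec d → Vec d} (hv : Differentiable ℝ v) (a : ℝ) :
    grad (a • v) = a • grad v := by
  funext x
  ext p
  simp [grad, fderiv_const_smul (hv x)]

theorem continuous_grad {d : ℕ} {v : Vec d → Vec d} (hv : ContDiff ℝ ∞ v) :
    Continuous (grad v) := by
  refine (PiLp.continuous_toLp 2 _).comp (continuous_pi fun p => ?_)
  exact (EuclideanSpace.proj (𝕜 := ℝ) p.1 : Vec d →L[ℝ] ℝ).continuous.comp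
    ((hv.continuous_fderiv (by simp)).clm_apply continuous_const)

theorem HasZeroTrace.add {d : ℕ} {Ω : Set (Vec d)} {v w : Vec d → Vec d} {G H : Vec d → Mat d}
    (hv : HasZeroTrace Ω v G) (hw : HasZeroTrace Ω w H)
    (mv : AEStronglyMeasurable v (volume.restrict Ω))
    (mG : AEStronglyMeasurable G (volume.restrict Ω)) : HasZeroTrace Ω (v + w) (G + H) := by
  intro ε hε
  obtain ⟨ψ, hψ, h₁⟩ := hv (ε / 2) (ENNReal.half_pos hε.ne')
  obtain ⟨χ, hχ, h₂⟩ := hw (ε / 2) (ENNReal.half_pos hε.ne')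
  refine ⟨ψ + χ, hψ.add hχ, ?_⟩
  have e₁ : (fun x => (v + w) x - (ψ + χ) x) = (fun x => v x - ψ x) + fun x => w x - χ x := by
    funext x
    simp only [Pi.add_apply]
    abel
  have e₂ : (fun x => (G + H) x - grad (ψ + χ) x) =
      (fun x => G x - grad ψ x) + fun x => H x - grad χ x := by
    rw [grad_add (hψ.1.differentiable (by simp)) (hχ.1.differentiable (by simp))]
    funext x
    simp only [Pi.add_apply]
    abel
  have add_le : ∀ {X : Type} [NormedAddCommGroup X] (a b : Vec d → X),
      AEStronglyMeasurable a (volume.restrict Ω) →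
      eLpNorm (a + b) 1 (volume.restrict Ω) ≤
        eLpNorm a 1 (volume.restrict Ω) + eLpNorm b 1 (volume.restrict Ω) := by
    intro X _ a b ha
    simp only [eLpNorm_one_eq_lintegral_enorm, Pi.add_apply]
    rw [← lintegral_add_left' ha.enorm]
    exact lintegral_mono fun x => enorm_add_le _ _
  rw [e₁, e₂]
  refine (add_le_add
    (add_le _ _ (mv.sub hψ.1.continuous.aestronglyMeasurable))
    (add_le _ _ (mG.sub (continuous_grad hψ.1).aestronglyMeasurable))).trans_lt ?_
  rw [add_add_add_comm]
  exact (ENNReal.add_lt_add h₁ h₂).trans_eq (ENNReal.add_halves ε)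

theorem HasZeroTrace.const_smul {d : ℕ} {Ω : Set (Vec d)} {v : Vec d → Vec d} {G : Vec d → Mat d}
    (hv : HasZeroTrace Ω v G) (a : ℝ) : HasZeroTrace Ω (a • v) (a • G) := by
  intro ε hε
  by_cases ha : a = 0
  · refine ⟨0, ⟨contDiff_const, HasCompactSupport.zero, by simp⟩, ?_⟩
    have : grad (0 : Vec d → Vec d) = 0 := by
      funext x
      ext p
      simp [grad]
    simpa [this, ha] using hε
  have hpos : ‖a‖ₑ ≠ 0 := by simpa using ha
  obtain ⟨ψ, hψ, h⟩ := hv (ε / ‖a‖ₑ) (ENNReal.div_pos hε.ne' enorm_ne_top)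
  refine ⟨a • ψ, hψ.const_smul a, ?_⟩
  have e₁ : (fun x => (a • v) x - (a • ψ) x) = a • fun x => v x - ψ x := by
    funext x
    simp only [Pi.smul_apply, smul_sub]
  have e₂ : (fun x => (a • G) x - grad (a • ψ) x) = a • fun x => G x - grad ψ x := by
    rw [grad_const_smul (hψ.1.differentiable (by simp))]
    funext x
    simp only [Pi.smul_apply, smul_sub]
  rw [e₁, e₂, eLpNorm_const_smul, eLpNorm_const_smul, ← mul_add, mul_comm]
  exact (ENNReal.lt_div_iff_mul_lt (Or.inl hpos) (Or.inl enorm_ne_top)).1 h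

/-- The vector-valued space `W^{1,∞}_0(Ω)`. -/
def W01Infty {d : ℕ} (Ω : Set (Vec d)) : Submodule ℝ (Vec d → Vec d) where
  carrier := {v | ∃ G, HasWeakGrad Ω v G ∧ MemLp v ⊤ (volume.restrict Ω) ∧
    MemLp G ⊤ (volume.restrict Ω) ∧ HasZeroTrace Ω v G}
  zero_mem' := by
    refine ⟨0, ⟨locallyIntegrableOn_zero, locallyIntegrableOn_zero, by simp⟩,
      MemLp.zero, MemLp.zero, fun ε hε => ⟨0, ⟨contDiff_const, HasCompactSupport.zero, by simp⟩, ?_⟩⟩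
    have : grad (0 : Vec d → Vec d) = 0 := by
      funext x
      ext p
      simp [grad]
    simpa [this] using hε
  add_mem' := by
    rintro v w ⟨G, h₁, h₂, h₃, h₄⟩ ⟨H, k₁, k₂, k₃, k₄⟩
    exact ⟨G + H, h₁.add k₁, h₂.add k₂, h₃.add k₃, h₄.add k₄ h₂.1 h₃.1⟩
  smul_mem' := by
    rintro a v ⟨G, h₁, h₂, h₃, h₄⟩
    exact ⟨a • G, h₁.const_smul a, h₂.const_smul a, h₃.const_smul a, h₄.const_smul a⟩

/-- `f` is an element of the dual space `W^{-1,φ^*}(Ω)` of `W^{1,φ}_0(Ω)`, the latter with the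
norm `‖∇·‖_φ`. Only the values of `f` on `W^{1,φ}_0(Ω)` matter. -/
structure IsDualFunctional {d : ℕ} (φ : ℝ → ℝ) (Ω : Set (Vec d)) (f : (Vec d → Vec d) → ℝ) :
    Prop where
  map_add : ∀ v ∈ W01Phi φ Ω, ∀ w ∈ W01Phi φ Ω, f (v + w) = f v + f w
  map_smul : ∀ (a : ℝ), ∀ v ∈ W01Phi φ Ω, f (a • v) = a * f v
  bounded : ∃ M : ℝ, ∀ v ∈ W01Phi φ Ω, |f v| ≤ M * luxNorm φ Ω (weakGrad Ω v)

/-- `(u, p) ∈ W^{1,φ}_0(Ω) × L^{φ^*}_0(Ω)` is a weak solution of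
`-div A(Du) + ∇p = f`, `div u = 0` in `Ω`, `u = 0` on `∂Ω`. -/
structure IsWeakSolution {d : ℕ} (φ : ℝ → ℝ) (A : Mat d → Mat d) (Ω : Set (Vec d))
    (f : (Vec d → Vec d) → ℝ) (u : Vec d → Vec d) (p : Vec d → ℝ) : Prop where
  velocity_mem : u ∈ W01Phi φ Ω
  pressure_mem : MemLPhiZeroMean (conjugate φ) Ω p
  momentum : ∀ v ∈ W01Phi φ Ω,
    (∫ x in Ω, inner ℝ (A (symGrad Ω u x)) (symGrad Ω v x)) - (∫ x in Ω, p x * weakDiv Ω v x) =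
      f v
  mass : ∀ q, MemLPhiZeroMean (conjugate φ) Ω q → ∫ x in Ω, q x * weakDiv Ω u x = 0

/-! ### Meshes -/

/-- A finite face-to-face mesh of `d`-simplices in `ℝ^d`, given by the simplicial complex of its
elements and all their subsimplices; simplices are represented by their vertex sets. -/
structure Mesh (d : ℕ) where
  complex : Geometry.SimplicialComplex ℝ (Vec d)
  finite : complex.faces.Finite
  pure : ∀ s ∈ complex.faces, ∃ K ∈ complex.faces, s ⊆ K ∧ K.card = d + 1

/-- The closed simplex with the given vertices. -/
def hull {d : ℕ} (s : Finset (Vec d)) : Set (Vec d) := convexHull ℝ (s : Set (Vec d))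

namespace Mesh

variable {d : ℕ}

/-- The elements of the mesh: its `d`-simplices. -/
def elements (T : Mesh d) : Finset (Finset (Vec d)) :=
  T.finite.toFinset.filter fun K => K.card = d + 1

/-- The faces of the mesh: its `(d-1)`-simplices. -/
def sides (T : Mesh d) : Finset (Finset (Vec d)) :=
  T.finite.toFinset.filter fun F => F.card = d

/-- `T` is a decomposition of the bounded domain `Ω`. -/
structure IsMeshOf (T : Mesh d) (Ω : Set (Vec d)) : Prop where
  isOpen : IsOpen Ω
  isConnected : IsConnected Ω
  isBounded : Bornology.IsBounded Ω
  closure_eq : closure Ω = ⋃ K ∈ T.elements, hull K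

/-- The vertices of an element form an affine basis. -/
def elementBasis (T : Mesh d) (K : T.elements) : AffineBasis K.1 ℝ (Vec d) where
  toFun := (↑)
  ind' := T.complex.indep (by
    have := K.2
    simp only [elements, Finset.mem_filter, Set.Finite.mem_toFinset] at this
    exact this.1)
  tot' := by
    have := K.2
    simp only [elements, Finset.mem_filter, Set.Finite.mem_toFinset] at this
    rw [(T.complex.indep this.1).affineSpan_eq_top_iff_card_eq_finrank_add_one]
    simp [this.2]

open scoped Classical in
/-- The barycentric coordinate of the element `K` that belongs to its vertex `z`. -/
def bary (T : Mesh d) (K : T.elements) (z : Vec d) : Vec d →ᵃ[ℝ] ℝ :=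
  if h : z ∈ K.1 then (T.elementBasis K).coord ⟨z, h⟩ else 0

/-- The piecewise constant function in `S^0_0` with value `g K` in `K`. -/
def pw (T : Mesh d) (g : T.elements → ℝ) (x : Vec d) : ℝ :=
  ∑ K : T.elements, (interior (hull K.1)).indicator (fun _ => g K) x

/-! ### The Crouzeix-Raviart space -/

/-- Piecewise affine vector fields `(S^0_1)^d`, given by their restrictions to the elements. -/
abbrev BrokenP1 (T : Mesh d) := T.elements → (Vec d →ᵃ[ℝ] Vec d)

end Mesh

/-- The integral over a face with respect to the `(d-1)`-dimensional Hausdorff measure. -/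
def faceIntegral {d : ℕ} {X : Type*} [NormedAddCommGroup X] [NormedSpace ℝ X]
    (F : Finset (Vec d)) (g : Vec d → X) : X :=
  ∫ x in hull F, g x ∂(Measure.hausdorffMeasure ((d : ℝ) - 1))

theorem hausdorffMeasure_hull_lt_top {d : ℕ} (F : Finset (Vec d)) (hF : F.card = d) :
    Measure.hausdorffMeasure ((d : ℝ) - 1) (hull F) < ⊤ := by
  rcases F.eq_empty_or_nonempty with rfl | hne
  · simp [hull]
  obtain ⟨n, hn⟩ : ∃ n, F.card = n + 1 := ⟨F.card - 1, by have := hne.card_pos; omega⟩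
  let e := F.equivFinOfCardEq hn
  let z : Fin (n + 1) → Vec d := fun i => (e.symm i).1
  let L : (Fin n → ℝ) →L[ℝ] Vec d :=
    ∑ i : Fin n, (ContinuousLinearMap.proj (R := ℝ) (φ := fun _ : Fin n => ℝ) i).smulRight
      (z i.succ - z 0)
  have hsub : hull F ⊆ (fun y => z 0 + L y) '' Icc (0 : Fin n → ℝ) 1 := by
    intro x hx
    obtain ⟨w, hw₀, hw₁, hwx⟩ := Finset.mem_convexHull'.1 hx
    have hsum : ∀ {X : Type} [AddCommMonoid X] (g : Vec d → X),
        ∑ y ∈ F, g y = ∑ i : Fin (n + 1), g (z i) := by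
      intro X _ g
      rw [← Finset.sum_coe_sort F g]
      exact (Equiv.sum_comp e.symm (fun y : F => g y.1)).symm
    have hmem : ∀ i, z i ∈ F := fun i => (e.symm i).2
    refine ⟨fun i => w (z i.succ), ⟨fun i => hw₀ _ (hmem _), fun i => ?_⟩, ?_⟩
    · exact (Finset.single_le_sum hw₀ (hmem _)).trans_eq hw₁
    · rw [hsum, Fin.sum_univ_succ] at hw₁ hwx
      have h0 : w (z 0) = 1 - ∑ i : Fin n, w (z i.succ) := by linarith
      rw [← hwx, h0]
      simp only [L, _root_.sum_apply, ContinuousLinearMap.smulRight_apply,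
        ContinuousLinearMap.proj_apply, smul_sub, Finset.sum_sub_distrib, sub_smul, one_smul,
        Finset.sum_smul]
      abel
  have hL : LipschitzOnWith (0 + ‖L‖₊) (fun y => z 0 + L y) (Icc (0 : Fin n → ℝ) 1) :=
    ((LipschitzWith.const (z 0)).add L.lipschitz).lipschitzOnWith
  have hd : (d : ℝ) - 1 = (Fintype.card (Fin n) : ℝ) := by
    rw [Fintype.card_fin, ← hF, hn]
    push_cast
    ring
  rw [hd]
  refine (measure_mono hsub).trans_lt ((hL.hausdorffMeasure_image_le (by positivity)).trans_lt ?_)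
  rw [hausdorffMeasure_pi_real]
  exact ENNReal.mul_lt_top (ENNReal.rpow_lt_top_of_nonneg (by positivity) ENNReal.coe_ne_top)
    isCompact_Icc.measure_lt_top

theorem integrableOn_face {d : ℕ} (F : Finset (Vec d)) (hF : F.card = d)
    (g : Vec d →ᵃ[ℝ] Vec d) :
    IntegrableOn g (hull F) (Measure.hausdorffMeasure ((d : ℝ) - 1)) := by
  have hg : Continuous g := g.continuous_of_finiteDimensional
  have hc : IsCompact (hull F) := F.finite_toSet.isCompact_convexHull ℝ
  have : IsFiniteMeasure ((Measure.hausdorffMeasure ((d : ℝ) - 1)).restrict (hull F)) :=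
    ⟨by simpa using hausdorffMeasure_hull_lt_top F hF⟩
  obtain ⟨M, hM⟩ := hc.exists_bound_of_continuousOn hg.continuousOn
  exact Integrable.of_bound hg.aestronglyMeasurable M
    ((ae_restrict_iff' hc.measurableSet).2 (Eventually.of_forall hM))

namespace Mesh

variable {d : ℕ}

/-- The Crouzeix-Raviart space: the face mean values of jumps vanish. A face is a boundary face if
it lies on `∂Ω`, where the jump is the trace, and an interior face otherwise. -/
def CR (T : Mesh d) (Ω : Set (Vec d)) : Submodule ℝ T.BrokenP1 where
  carrier := {v | ∀ F ∈ T.sides,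
    (¬ hull F ⊆ frontier Ω → ∀ K₁ K₂ : T.elements, F ⊆ K₁.1 → F ⊆ K₂.1 →
      faceIntegral F (fun x => v K₁ x - v K₂ x) = 0) ∧
    (hull F ⊆ frontier Ω → ∀ K : T.elements, F ⊆ K.1 → faceIntegral F (fun x => v K x) = 0)}
  zero_mem' := by
    intro F _
    simp [faceIntegral]
  add_mem' := by
    intro v w hv hw F hF
    have hc : F.card = d := by
      simp only [sides, Finset.mem_filter] at hF
      exact hF.2
    refine ⟨fun hi K₁ K₂ h₁ h₂ => ?_, fun hb K h => ?_⟩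
    · have e : (fun x => (v + w) K₁ x - (v + w) K₂ x) =
          fun x => (v K₁ - v K₂) x + (w K₁ - w K₂) x := by
        funext x
        simp only [Pi.add_apply, AffineMap.coe_add, AffineMap.coe_sub, Pi.sub_apply]
        abel
      have hv' := (hv F hF).1 hi K₁ K₂ h₁ h₂
      have hw' := (hw F hF).1 hi K₁ K₂ h₁ h₂
      rw [e, faceIntegral, integral_add (integrableOn_face F hc _) (integrableOn_face F hc _)]
      simp only [faceIntegral] at hv' hw'
      simp only [AffineMap.coe_sub, Pi.sub_apply, hv', hw', add_zero]
    · have hv' := (hv F hF).2 hb K h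
      have hw' := (hw F hF).2 hb K h
      simp only [faceIntegral] at hv' hw' ⊢
      simp only [Pi.add_apply, AffineMap.coe_add]
      rw [integral_add (integrableOn_face F hc _) (integrableOn_face F hc _), hv', hw', add_zero]
  smul_mem' := by
    intro a v hv F hF
    refine ⟨fun hi K₁ K₂ h₁ h₂ => ?_, fun hb K h => ?_⟩
    · have hv' := (hv F hF).1 hi K₁ K₂ h₁ h₂
      simp only [faceIntegral] at hv' ⊢
      simp only [Pi.smul_apply, AffineMap.coe_smul, ← smul_sub]
      rw [integral_smul, hv', smul_zero]
    · have hv' := (hv F hF).2 hb K h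
      simp only [faceIntegral] at hv' ⊢
      simp only [Pi.smul_apply, AffineMap.coe_smul]
      rw [integral_smul, hv', smul_zero]

/-- The element-wise divergence of a piecewise affine field; it is constant in each element. -/
def divh (T : Mesh d) (v : T.BrokenP1) (K : T.elements) : ℝ :=
  ∑ i, (v K).linear (unitVec i) i

/-- The element-wise divergence-free Crouzeix-Raviart functions. -/
def Zh (T : Mesh d) (Ω : Set (Vec d)) : Set (T.CR Ω) :=
  {v | ∀ K, T.divh v.1 K = 0}

/-- Piecewise constant functions with integral zero over `Ω`. -/
def S00hat (T : Mesh d) (Ω : Set (Vec d)) : Set (T.elements → ℝ) :=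
  {q | ∫ x in Ω, T.pw q x = 0}

/-! ### The smoothing operator `E = A + B + C` -/

/-- Weights for nodal averaging: at each vertex inside `Ω`, a convex combination of the adjacent
elements. -/
def IsAveragingWeight (T : Mesh d) (Ω : Set (Vec d)) (α : Vec d → T.elements → ℝ) : Prop :=
  ∀ z ∈ Ω, ∀ K₀ : T.elements, z ∈ K₀.1 →
    (∀ K, 0 ≤ α z K) ∧ (∀ K : T.elements, z ∉ K.1 → α z K = 0) ∧ ∑ K, α z K = 1

open scoped Classical in
/-- The averaged nodal value of `v` at the vertex `z`; it is zero for vertices on `∂Ω`. -/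
def nodalValue (T : Mesh d) (Ω : Set (Vec d)) (α : Vec d → T.elements → ℝ) (v : T.BrokenP1)
    (z : Vec d) : Vec d :=
  if z ∈ Ω then ∑ K, α z K • v K z else 0

/-- The averaging operator into continuous piecewise affine fields, in the element `K`. -/
def averaging (T : Mesh d) (Ω : Set (Vec d)) (α : Vec d → T.elements → ℝ) (v : T.BrokenP1)
    (K : T.elements) (x : Vec d) : Vec d :=
  ∑ z ∈ K.1, T.bary K z x • T.nodalValue Ω α v z

/-- The bubble of the face `F`, in the element `K ⊇ F`. -/
def faceBubble (T : Mesh d) (F : Finset (Vec d)) (K : T.elements) (x : Vec d) : ℝ :=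
  ∏ z ∈ F, T.bary K z x

/-- The combination of face bubbles, in the element `K`, that has the same integral as `v - Av`
over each face of `K`. -/
def faceCorrection (T : Mesh d) (Ω : Set (Vec d)) (α : Vec d → T.elements → ℝ) (v : T.BrokenP1)
    (K : T.elements) (x : Vec d) : Vec d :=
  ∑ F ∈ K.1.powersetCard d, T.faceBubble F K x •
    ((faceIntegral F (T.faceBubble F K))⁻¹ •
      faceIntegral F fun y => v K y - T.averaging Ω α v K y)

/-- The subsimplex of `K` spanned by the barycentre of `K` and the vertices of `K` other than `z`;
it consists of the points of `K` at which the barycentric coordinate of `z` is the smallest. These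
sets, for the vertices `z` of `K`, form the barycentric refinement of `K`. -/
def subElement (T : Mesh d) (K : T.elements) (z : Vec d) : Set (Vec d) :=
  {x ∈ hull K.1 | ∀ y ∈ K.1, T.bary K z x ≤ T.bary K y x}

/-- Element bubbles: continuous fields on `K` that vanish on `∂K` and are polynomial on each
simplex of the barycentric refinement of `K`. -/
def IsElementBubble (T : Mesh d) (K : T.elements) (w : Vec d → Vec d) : Prop :=
  ContinuousOn w (hull K.1) ∧ (∀ x ∈ frontier (hull K.1), w x = 0) ∧
    ∀ z ∈ K.1, ∀ i : Fin d, ∃ P : MvPolynomial (Fin d) ℝ,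
      ∀ x ∈ T.subElement K z, w x i = MvPolynomial.eval (fun j => x j) P

/-- `w` solves the local problem for the element bubble correction in `K`: it is an element bubble
and, in each simplex of the barycentric refinement of `K`, `div w = div v - div (Av + Bv)`. -/
structure IsElementCorrection (T : Mesh d) (Ω : Set (Vec d)) (α : Vec d → T.elements → ℝ)
    (v : T.BrokenP1) (K : T.elements) (w : Vec d → Vec d) : Prop where
  isElementBubble : T.IsElementBubble K w
  div_eq : ∀ z ∈ K.1, ∀ x ∈ interior (T.subElement K z),
    tr (grad w x) = T.divh v K -
      tr (grad (fun y => T.averaging Ω α v K y + T.faceCorrection Ω α v K y) x)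

/-- `E : CR → W^{1,∞}_0(Ω)` is the divergence-preserving smoothing operator: in each element `Ev`
is the sum of the nodal average of `v`, the face bubble correction and an element bubble
correction. -/
def IsSmoothingOperator (T : Mesh d) (Ω : Set (Vec d)) (E : T.CR Ω →ₗ[ℝ] W01Infty Ω) : Prop :=
  ∃ α, T.IsAveragingWeight Ω α ∧ ∀ (v : T.CR Ω) (K : T.elements),
    ∃ w, T.IsElementCorrection Ω α v.1 K w ∧ ∀ x ∈ hull K.1,
      (E v).1 x = T.averaging Ω α v.1 K x + T.faceCorrection Ω α v.1 K x + w x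

/-- `(u_h, p_h)` is a discrete solution: `p_h` has mean value zero and
`∫ A(D E u_h) : D E v_h - ∫ p_h div_h v_h = ⟨f, E v_h⟩` for all `v_h`, and
`∫ q_h div_h u_h = 0` for all `q_h`. -/
structure IsDiscreteSolution (T : Mesh d) (Ω : Set (Vec d)) (A : Mat d → Mat d)
    (E : T.CR Ω →ₗ[ℝ] W01Infty Ω) (f : (Vec d → Vec d) → ℝ)
    (uh : T.CR Ω) (ph : T.elements → ℝ) : Prop where
  pressure_mem : ph ∈ T.S00hat Ω
  momentum : ∀ vh : T.CR Ω,
    (∫ x in Ω, inner ℝ (A (symGrad Ω (E uh).1 x)) (symGrad Ω (E vh).1 x)) -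
      (∫ x in Ω, T.pw ph x * T.pw (T.divh vh.1) x) = f (E vh).1
  mass : ∀ qh ∈ T.S00hat Ω, ∫ x in Ω, T.pw qh x * T.pw (T.divh uh.1) x = 0

end Mesh

/-- The natural distance `‖F(Du) - F(Dv)‖_2` in `Ω`. -/
def natDist {d : ℕ} (φ : ℝ → ℝ) (Ω : Set (Vec d)) (u v : Vec d → Vec d) : ℝ≥0∞ :=
  eLpNorm (fun x => natF φ (symGrad Ω u x) - natF φ (symGrad Ω v x)) 2 (volume.restrict Ω)

end NonlinearStokes

end

/-!
With `h = φ'`, the operators `A` and `F` are strongly monotone and Lipschitz with respect to the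
weights `w(P, Q) = h(|P| + |Q|) / (|P| + |Q|)` and `√w(P, Q)` respectively, because `F` is the
radial operator of `√(h(t) t)`. Hence `(A(P) - A(Q)) : (P - Q)` is equivalent to
`w(P, Q) |P - Q|²` and to `|F(P) - F(Q)|²`. Either `|P - R|` is a small fraction of `|P - Q|` or,
by the growth of `h`, `w(P, Q) |P - Q| ≲ w(P, R) |P - R|`; this gives the Young inequality
`(A(P) - A(Q)) : (P - R) ≤ ½ (A(P) - A(Q)) : (P - Q) + K |F(P) - F(R)|²`.

Since `E` preserves the divergence, it maps `Z_h` to solenoidal fields. Testing both momentum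
equations with `E(u_h - v_h)`, `v_h ∈ Z_h`, therefore eliminates both pressures and leaves the
Galerkin orthogonality `∫ (A(Du) - A(DEu_h)) : (DEu_h - DEv_h) = 0`. With `P = Du`, `Q = DEu_h`
and `R = DEv_h` the Young inequality absorbs the error and gives quasi-optimality, uniformly in
`v_h`.
-/

noncomputable section

namespace NonlinearStokes

/-! ### Functions of power-like growth -/

/-- Positive differentiable functions on `(0, ∞)` whose logarithmic index `t h'(t) / h(t)` lies
in `[a, b]`. A uniformly convex N-function `φ` enters the estimates only through `h = φ'`. -/
structure IsPowerLike (h : ℝ → ℝ) (a b : ℝ) : Prop where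
  a_pos : 0 < a
  differentiableAt : ∀ t, 0 < t → DifferentiableAt ℝ h t
  pos : ∀ t, 0 < t → 0 < h t
  lower : ∀ t, 0 < t → a * h t ≤ deriv h t * t
  upper : ∀ t, 0 < t → deriv h t * t ≤ b * h t

namespace IsPowerLike

variable {h : ℝ → ℝ} {a b : ℝ}

theorem b_pos (H : IsPowerLike h a b) : 0 < b :=
  H.a_pos.trans_le <| le_of_mul_le_mul_right ((H.lower 1 one_pos).trans (H.upper 1 one_pos))
    (H.pos 1 one_pos)

theorem deriv_pos (H : IsPowerLike h a b) {t : ℝ} (ht : 0 < t) : 0 < deriv h t :=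
  pos_of_mul_pos_left ((mul_pos H.a_pos (H.pos t ht)).trans_le (H.lower t ht)) ht.le

theorem hasDerivAt_mul_rpow_neg (H : IsPowerLike h a b) (e : ℝ) {t : ℝ} (ht : 0 < t) :
    HasDerivAt (fun t => h t * t ^ (-e)) ((deriv h t * t - e * h t) * t ^ (-e - 1)) t := by
  have hd := (H.differentiableAt t ht).hasDerivAt.mul
    (Real.hasDerivAt_rpow_const (p := -e) (Or.inl ht.ne'))
  refine hd.congr_deriv ?_
  rw [show t ^ (-e) = t ^ (-e - 1) * t by rw [← Real.rpow_add_one ht.ne', sub_add_cancel]]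
  ring

theorem continuousOn_mul_rpow_neg (H : IsPowerLike h a b) (e : ℝ) :
    ContinuousOn (fun t => h t * t ^ (-e)) (Ioi 0) :=
  fun _ ht => (H.hasDerivAt_mul_rpow_neg e ht).continuousAt.continuousWithinAt

theorem monotoneOn_mul_rpow_neg (H : IsPowerLike h a b) {e : ℝ} (he : e ≤ a) :
    MonotoneOn (fun t => h t * t ^ (-e)) (Ioi 0) := by
  refine monotoneOn_of_hasDerivWithinAt_nonneg (convex_Ioi 0) (H.continuousOn_mul_rpow_neg e)
    (fun t ht => (H.hasDerivAt_mul_rpow_neg e (interior_subset ht)).hasDerivWithinAt)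
    fun t ht => ?_
  have ht : 0 < t := interior_subset ht
  exact mul_nonneg (sub_nonneg.2 ((mul_le_mul_of_nonneg_right he (H.pos t ht).le).trans
    (H.lower t ht))) (Real.rpow_nonneg ht.le _)

theorem antitoneOn_mul_rpow_neg (H : IsPowerLike h a b) :
    AntitoneOn (fun t => h t * t ^ (-b)) (Ioi 0) := by
  refine antitoneOn_of_hasDerivWithinAt_nonpos (convex_Ioi 0) (H.continuousOn_mul_rpow_neg b)
    (fun t ht => (H.hasDerivAt_mul_rpow_neg b (interior_subset ht)).hasDerivWithinAt)
    fun t ht => ?_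
  have ht : 0 < t := interior_subset ht
  exact mul_nonpos_of_nonpos_of_nonneg (sub_nonpos.2 (H.upper t ht)) (Real.rpow_nonneg ht.le _)

theorem monotoneOn (H : IsPowerLike h a b) : MonotoneOn h (Ioi 0) := by
  simpa using H.monotoneOn_mul_rpow_neg H.a_pos.le

theorem map_mul_le (H : IsPowerLike h a b) {l t : ℝ} (hl : 1 ≤ l) (ht : 0 < t) :
    h (l * t) ≤ l ^ b * h t := by
  have hl0 : 0 < l := one_pos.trans_le hl
  have hle : h (l * t) * (l * t) ^ (-b) ≤ h t * t ^ (-b) :=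
    H.antitoneOn_mul_rpow_neg ht (mul_pos hl0 ht) (le_mul_of_one_le_left ht.le hl)
  have hlb := Real.rpow_pos_of_pos hl0 b
  have htb := Real.rpow_pos_of_pos ht b
  rw [Real.mul_rpow hl0.le ht.le, Real.rpow_neg hl0.le, Real.rpow_neg ht.le, ← mul_assoc] at hle
  have := le_of_mul_le_mul_right hle (inv_pos.2 htb)
  rwa [mul_inv_le_iff₀ hlb, mul_comm (h t)] at this

theorem tendsto_zero (H : IsPowerLike h a b) : Tendsto h (𝓝[>] 0) (𝓝 0) := by
  have hbound : ∀ t ∈ Ioc (0 : ℝ) 1, h t ≤ h 1 * t ^ a := fun t ht => by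
    have := H.monotoneOn_mul_rpow_neg le_rfl ht.1 (mem_Ioi.2 one_pos) ht.2
    simpa [Real.rpow_neg ht.1.le, mul_inv_le_iff₀ (Real.rpow_pos_of_pos ht.1 a)] using this
  have hpow : Tendsto (fun t : ℝ => h 1 * t ^ a) (𝓝[>] 0) (𝓝 0) := by
    have := (Real.continuousAt_rpow_const 0 a (Or.inr H.a_pos.le)).tendsto.const_mul (h 1)
    rw [Real.zero_rpow H.a_pos.ne', mul_zero] at this
    exact this.mono_left nhdsWithin_le_nhds
  refine squeeze_zero' ?_ ?_ hpow
  · filter_upwards [self_mem_nhdsWithin] with t ht using (H.pos t ht).le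
  · filter_upwards [Ioc_mem_nhdsGT (zero_lt_one (α := ℝ))] using hbound

theorem le_deriv (H : IsPowerLike h a b) {s M : ℝ} (hM : 0 < M) (hs : M / 4 ≤ s) (hsM : s ≤ M) :
    a * (4 ^ b)⁻¹ * (h M / M) ≤ deriv h s := by
  have hs0 : 0 < s := by linarith
  have h4 : (0 : ℝ) < 4 ^ b := by positivity
  have hle : h M ≤ 4 ^ b * h s :=
    (H.monotoneOn hM (mem_Ioi.2 (by positivity)) (by linarith)).trans
      (H.map_mul_le (by norm_num) hs0)
  calc a * (4 ^ b)⁻¹ * (h M / M) = a * ((4 ^ b)⁻¹ * h M) / M := by ring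
    _ ≤ a * h s / M := by
      have := H.a_pos
      gcongr
      rwa [inv_mul_le_iff₀ h4]
    _ ≤ deriv h s := by
      rw [div_le_iff₀ hM]
      exact (H.lower s hs0).trans (mul_le_mul_of_nonneg_left hsM (H.deriv_pos hs0).le)

theorem deriv_le (H : IsPowerLike h a b) {s M : ℝ} (hM : 0 < M) (hs : M / 4 ≤ s) (hsM : s ≤ M) :
    deriv h s ≤ 4 * b * (h M / M) := by
  have hs0 : 0 < s := by linarith
  have hle : deriv h s * s ≤ b * h M :=
    (H.upper s hs0).trans (mul_le_mul_of_nonneg_left (H.monotoneOn hs0 hM hsM) H.b_pos.le)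
  rw [show 4 * b * (h M / M) = b * h M / (M / 4) by field_simp, le_div_iff₀ (by positivity)]
  exact (mul_le_mul_of_nonneg_left hs (H.deriv_pos hs0).le).trans hle

theorem sqrt_mul_id (H : IsPowerLike h a b) :
    IsPowerLike (fun t => √(h t * t)) ((a + 1) / 2) ((b + 1) / 2) := by
  have hpos : ∀ t, 0 < t → 0 < h t * t := fun t ht => mul_pos (H.pos t ht) ht
  have hd : ∀ t, 0 < t → HasDerivAt (fun t => √(h t * t))
      ((deriv h t * t + h t) / (2 * √(h t * t))) t := fun t ht => by
    simpa using ((H.differentiableAt t ht).hasDerivAt.mul (hasDerivAt_id t)).sqrt (hpos t ht).ne'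
  have hindex : ∀ t, 0 < t → deriv (fun t => √(h t * t)) t * t =
      (deriv h t * t / h t + 1) / 2 * √(h t * t) := fun t ht => by
    have := H.pos t ht
    rw [(hd t ht).deriv]
    field_simp
    rw [Real.sq_sqrt (by positivity)]
    ring
  refine ⟨by linarith [H.a_pos], fun t ht => (hd t ht).differentiableAt,
    fun t ht => Real.sqrt_pos.2 (hpos t ht), fun t ht => ?_, fun t ht => ?_⟩ <;>
    rw [hindex t ht] <;> gcongr
  · exact (le_div_iff₀ (H.pos t ht)).2 (H.lower t ht)
  · exact (div_le_iff₀ (H.pos t ht)).2 (H.upper t ht)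

end IsPowerLike

/-! ### Monotone operators with a power-like weight -/

section Monotone

variable {V : Type*} [NormedAddCommGroup V]

/-- The weight `h(|P| + |Q|) / (|P| + |Q|)`, which compares `A(P) - A(Q)` with `P - Q`; it is zero
for `P = Q = 0`. -/
def weight (h : ℝ → ℝ) (P Q : V) : ℝ := h (‖P‖ + ‖Q‖) / (‖P‖ + ‖Q‖)

theorem weight_comm (h : ℝ → ℝ) (P Q : V) : weight h P Q = weight h Q P := by
  rw [weight, weight, add_comm]

theorem weight_nonneg {h : ℝ → ℝ} {a b : ℝ} (H : IsPowerLike h a b) (P Q : V) :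
    0 ≤ weight h P Q := by
  rcases (add_nonneg (norm_nonneg P) (norm_nonneg Q)).eq_or_lt' with hM | hM
  · simp [weight, hM]
  · exact div_nonneg (H.pos _ hM).le hM.le

theorem weight_sqrt_mul_id_sq {h : ℝ → ℝ} {a b : ℝ} (H : IsPowerLike h a b) (P Q : V) :
    weight (fun t => √(h t * t)) P Q ^ 2 = weight h P Q := by
  rcases (add_nonneg (norm_nonneg P) (norm_nonneg Q)).eq_or_lt' with hM | hM
  · simp [weight, hM]
  · rw [weight, div_pow, Real.sq_sqrt (mul_pos (H.pos _ hM) hM).le, sq,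
      mul_div_mul_right _ _ hM.ne', weight]

theorem norm_add_norm_le_of_norm_sub_le {l : ℝ} (hl : 1 ≤ l) {P Q R : V}
    (hQR : ‖P - Q‖ ≤ l * ‖P - R‖) : ‖P‖ + ‖Q‖ ≤ 3 * l * (‖P‖ + ‖R‖) := by
  have hQ : ‖P‖ + ‖Q‖ ≤ 2 * ‖P‖ + ‖P - Q‖ := by linarith [norm_sub_norm_le Q P, norm_sub_rev P Q]
  nlinarith [norm_sub_le P R, norm_nonneg P, norm_nonneg R]

theorem norm_sub_div_le_of_norm_sub_le {l : ℝ} (hl : 1 ≤ l) {P Q R : V}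
    (hQR : ‖P - Q‖ ≤ l * ‖P - R‖) (hPQ : 0 < ‖P‖ + ‖Q‖) (hPR : 0 < ‖P‖ + ‖R‖) :
    ‖P - Q‖ / (‖P‖ + ‖Q‖) ≤ 3 * l * ‖P - R‖ / (‖P‖ + ‖R‖) := by
  have hR : ‖P‖ + ‖R‖ ≤ 2 * ‖P‖ + ‖P - R‖ := by linarith [norm_sub_norm_le R P, norm_sub_rev P R]
  rw [div_le_div_iff₀ hPQ hPR]
  calc ‖P - Q‖ * (‖P‖ + ‖R‖) ≤ ‖P - Q‖ * (2 * ‖P‖) + ‖P - Q‖ * ‖P - R‖ := by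
        rw [← mul_add]
        gcongr
    _ ≤ l * ‖P - R‖ * (2 * (‖P‖ + ‖Q‖)) + l * (‖P‖ + ‖Q‖) * ‖P - R‖ := by
        gcongr
        · exact le_add_of_nonneg_right (norm_nonneg Q)
        · exact (norm_sub_le P Q).trans (le_mul_of_one_le_left hPQ.le hl)
    _ = 3 * l * ‖P - R‖ * (‖P‖ + ‖Q‖) := by ring

theorem weight_change_of_shift {h : ℝ → ℝ} {a b : ℝ} (H : IsPowerLike h a b) {l : ℝ} (hl : 1 ≤ l)
    {P Q R : V} (hQR : ‖P - Q‖ ≤ l * ‖P - R‖) :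
    weight h P Q * ‖P - Q‖ ≤ 3 * l * (3 * l) ^ b * (weight h P R * ‖P - R‖) := by
  rcases (norm_nonneg (P - Q)).eq_or_lt' with h0 | hPQ
  · have := weight_nonneg H P R
    rw [h0, mul_zero]
    positivity
  have hPR : 0 < ‖P - R‖ := pos_of_mul_pos_right (hPQ.trans_le hQR) (by linarith)
  have hM : 0 < ‖P‖ + ‖Q‖ := hPQ.trans_le (norm_sub_le P Q)
  have hN : 0 < ‖P‖ + ‖R‖ := hPR.trans_le (norm_sub_le P R)
  calc weight h P Q * ‖P - Q‖ = h (‖P‖ + ‖Q‖) * (‖P - Q‖ / (‖P‖ + ‖Q‖)) := by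
        rw [weight, div_mul_eq_mul_div, mul_div_assoc]
    _ ≤ (3 * l) ^ b * h (‖P‖ + ‖R‖) * (3 * l * ‖P - R‖ / (‖P‖ + ‖R‖)) := by
        have := H.pos _ hN
        gcongr ?_ * ?_
        · exact (H.monotoneOn hM (mem_Ioi.2 (by positivity))
            (norm_add_norm_le_of_norm_sub_le hl hQR)).trans (H.map_mul_le (by linarith) hN)
        · exact norm_sub_div_le_of_norm_sub_le hl hQR hM hN
    _ = 3 * l * (3 * l) ^ b * (weight h P R * ‖P - R‖) := by
        rw [weight]
        ring

variable [InnerProductSpace ℝ V]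

/-- `A` is strongly monotone and Lipschitz continuous with respect to the weight given by `h`. -/
structure IsWeightedMonotone (h : ℝ → ℝ) (k K : ℝ) (A : V → V) : Prop where
  k_pos : 0 < k
  lower : ∀ P Q, k * weight h P Q * ‖P - Q‖ ^ 2 ≤ inner ℝ (A P - A Q) (P - Q)
  upper : ∀ P Q, ‖A P - A Q‖ ≤ K * weight h P Q * ‖P - Q‖

theorem IsWeightedMonotone.le_norm_sub {h : ℝ → ℝ} {k K : ℝ} {A : V → V}
    (hA : IsWeightedMonotone h k K A) (P Q : V) : k * weight h P Q * ‖P - Q‖ ≤ ‖A P - A Q‖ := by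
  rcases (norm_nonneg (P - Q)).eq_or_lt' with h0 | hs
  · simp [h0]
  · refine le_of_mul_le_mul_right ?_ hs
    rw [mul_assoc, ← sq]
    exact (hA.lower P Q).trans (real_inner_le_norm _ _)

/-- `A` has `φ`-structure with `h = φ'`: it is continuous, vanishes at `0`, and away from `0` its
derivative is bounded from below and above in terms of `h'(|Q|)`. -/
structure HasStructure (h : ℝ → ℝ) (c₀ c₁ : ℝ) (A : V → V) : Prop where
  c₀_pos : 0 < c₀
  c₁_nonneg : 0 ≤ c₁
  continuous : Continuous A
  map_zero : A 0 = 0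
  differentiableAt : ∀ Q, Q ≠ 0 → DifferentiableAt ℝ A Q
  lower : ∀ P Q, Q ≠ 0 → c₀ * deriv h ‖Q‖ * ‖P‖ ^ 2 ≤ inner ℝ (fderiv ℝ A Q P) P
  upper : ∀ Q, Q ≠ 0 → ‖fderiv ℝ A Q‖ ≤ c₁ * deriv h ‖Q‖

theorem monotone_of_hasDerivAt_nonneg_of_ne {k k' : ℝ → ℝ} (t₀ : ℝ) (hk : Continuous k)
    (hd : ∀ t, t ≠ t₀ → HasDerivAt k (k' t) t) (hn : ∀ t, t ≠ t₀ → 0 ≤ k' t) : Monotone k := by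
  have hl : MonotoneOn k (Iic t₀) := by
    refine monotoneOn_of_hasDerivWithinAt_nonneg (f' := k') (convex_Iic _) hk.continuousOn ?_ ?_ <;>
      rw [interior_Iic]
    · exact fun t ht => (hd t (ne_of_lt ht)).hasDerivWithinAt
    · exact fun t ht => hn t (ne_of_lt ht)
  have hr : MonotoneOn k (Ici t₀) := by
    refine monotoneOn_of_hasDerivWithinAt_nonneg (f' := k') (convex_Ici _) hk.continuousOn ?_ ?_ <;>
      rw [interior_Ici]
    · exact fun t ht => (hd t (ne_of_gt ht)).hasDerivWithinAt
    · exact fun t ht => hn t (ne_of_gt ht)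
  exact hl.Iic_union_Ici hr

theorem exists_forall_ne_lineMap_ne {P Q : V} (hPQ : P ≠ Q) (R : V) :
    ∃ t₀ : ℝ, ∀ t, t ≠ t₀ → AffineMap.lineMap Q P t ≠ R := by
  by_cases hz : ∃ t₀ : ℝ, AffineMap.lineMap Q P t₀ = R
  · obtain ⟨t₀, rfl⟩ := hz
    exact ⟨t₀, fun t ht h => ht (AffineMap.lineMap_injective ℝ hPQ.symm h)⟩
  · exact ⟨0, fun t _ h => hz ⟨t, h⟩⟩

theorem norm_lineMap_mem_Icc {P Q : V} (hPQ : ‖Q‖ ≤ ‖P‖) {t : ℝ} (ht : t ∈ Icc (3 / 4 : ℝ) 1) :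
    ‖AffineMap.lineMap Q P t‖ ∈ Icc ((‖P‖ + ‖Q‖) / 4) (‖P‖ + ‖Q‖) := by
  have hP : ‖t • P‖ = t * ‖P‖ := by rw [norm_smul, Real.norm_of_nonneg (by linarith [ht.1])]
  have hQ : ‖(1 - t) • Q‖ = (1 - t) * ‖Q‖ := by
    rw [norm_smul, Real.norm_of_nonneg (by linarith [ht.2])]
  have hlow := norm_sub_le_norm_add (t • P) ((1 - t) • Q)
  have hup := norm_add_le (t • P) ((1 - t) • Q)
  rw [AffineMap.lineMap_apply_module, add_comm ((1 - t) • Q)]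
  constructor <;> nlinarith [ht.1, ht.2, norm_nonneg Q]

namespace HasStructure

variable {h : ℝ → ℝ} {a b c₀ c₁ : ℝ} {A : V → V}

theorem continuous_inner_lineMap (hA : HasStructure h c₀ c₁ A) (P Q : V) :
    Continuous fun t : ℝ => inner ℝ (A (AffineMap.lineMap Q P t)) (P - Q) :=
  (hA.continuous.comp AffineMap.lineMap_continuous).inner continuous_const

theorem hasDerivAt_inner_lineMap (hA : HasStructure h c₀ c₁ A) {P Q : V} {t : ℝ}
    (ht : AffineMap.lineMap Q P t ≠ 0) :
    HasDerivAt (fun t : ℝ => inner ℝ (A (AffineMap.lineMap Q P t)) (P - Q))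
      (inner ℝ (fderiv ℝ A (AffineMap.lineMap Q P t) (P - Q)) (P - Q)) t := by
  simpa using ((hA.differentiableAt _ ht).hasFDerivAt.comp_hasDerivAt t
    AffineMap.hasDerivAt_lineMap).inner ℝ (hasDerivAt_const t (P - Q))

theorem monotone_inner_lineMap (H : IsPowerLike h a b) (hA : HasStructure h c₀ c₁ A) {P Q : V}
    (hPQ : P ≠ Q) : Monotone fun t : ℝ => inner ℝ (A (AffineMap.lineMap Q P t)) (P - Q) := by
  obtain ⟨t₀, ht₀⟩ := exists_forall_ne_lineMap_ne hPQ 0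
  refine monotone_of_hasDerivAt_nonneg_of_ne t₀ (hA.continuous_inner_lineMap P Q)
    (fun t ht => hA.hasDerivAt_inner_lineMap (ht₀ t ht)) fun t ht => ?_
  have hc₀ := hA.c₀_pos
  have hd := H.deriv_pos (norm_pos_iff.2 (ht₀ t ht))
  exact le_trans (by positivity) (hA.lower (P - Q) _ (ht₀ t ht))

theorem le_inner_of_norm_le (H : IsPowerLike h a b) (hA : HasStructure h c₀ c₁ A) {P Q : V}
    (hPQ : ‖Q‖ ≤ ‖P‖) :
    c₀ * a * (4 ^ b)⁻¹ / 4 * weight h P Q * ‖P - Q‖ ^ 2 ≤ inner ℝ (A P - A Q) (P - Q) := by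
  rcases eq_or_ne P Q with rfl | hne
  · simp
  have hM : 0 < ‖P‖ + ‖Q‖ := by
    rcases (norm_nonneg P).eq_or_lt' with hP | hP
    · rw [hP, norm_le_zero_iff] at hPQ
      exact absurd ((norm_eq_zero.1 hP).trans hPQ.symm) hne
    · positivity
  have hne0 : ∀ t ∈ Icc (3 / 4 : ℝ) 1, AffineMap.lineMap Q P t ≠ 0 := fun t ht =>
    norm_pos_iff.1 ((div_pos hM four_pos).trans_le (norm_lineMap_mem_Icc hPQ ht).1)
  set C := c₀ * (a * (4 ^ b)⁻¹ * weight h P Q) * ‖P - Q‖ ^ 2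
  have hderiv : ∀ t ∈ Icc (3 / 4 : ℝ) 1,
      C ≤ inner ℝ (fderiv ℝ A (AffineMap.lineMap Q P t) (P - Q)) (P - Q) := by
    intro t ht
    refine le_trans ?_ (hA.lower (P - Q) _ (hne0 t ht))
    have := hA.c₀_pos
    unfold C
    gcongr
    exact H.le_deriv hM (norm_lineMap_mem_Icc hPQ ht).1 (norm_lineMap_mem_Icc hPQ ht).2
  -- the last quarter of the segment from `Q` to `P` stays away from `0`; on the rest of it, which
  -- may pass through `0`, monotonicity suffices
  have hlast := (convex_Icc (3 / 4 : ℝ) 1).mul_sub_le_image_sub_of_le_deriv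
    (hA.continuous_inner_lineMap P Q).continuousOn
    (fun t ht => (hA.hasDerivAt_inner_lineMap
      (hne0 t (interior_subset ht))).differentiableAt.differentiableWithinAt)
    (C := C) (fun t ht => by
      rw [(hA.hasDerivAt_inner_lineMap (hne0 t (interior_subset ht))).deriv]
      exact hderiv t (interior_subset ht))
    (3 / 4) (by norm_num) 1 (by norm_num) (by norm_num)
  have hfirst := hA.monotone_inner_lineMap H hne (show (0 : ℝ) ≤ 3 / 4 by norm_num)
  simp only [AffineMap.lineMap_apply_zero, AffineMap.lineMap_apply_one] at hfirst hlast
  rw [inner_sub_left]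
  linarith

theorem norm_sub_map_smul_le (H : IsPowerLike h a b) (hA : HasStructure h c₀ c₁ A) {P : V}
    (hP : P ≠ 0) {e : ℝ} (he : e ∈ Ioc (0 : ℝ) 1) :
    ‖A P - A (e • P)‖ ≤ c₁ * (h ‖P‖ - h (e * ‖P‖)) := by
  have hpos : ∀ t ∈ Icc e 1, 0 < t := fun t ht => he.1.trans_le ht.1
  have hf : ∀ t ∈ Icc e 1, HasDerivAt (fun t : ℝ => A (t • P) - A (e • P))
      (fderiv ℝ A (t • P) P) t := fun t ht => by
    have hd := hA.differentiableAt _ (smul_ne_zero (hpos t ht).ne' hP)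
    simpa using (hd.hasFDerivAt.comp_hasDerivAt t ((hasDerivAt_id t).smul_const P)).sub_const
      (A (e • P))
  have hB : ∀ t ∈ Icc e 1, HasDerivAt (fun t : ℝ => c₁ * (h (t * ‖P‖) - h (e * ‖P‖)))
      (c₁ * (deriv h (t * ‖P‖) * ‖P‖)) t := fun t ht => by
    have hd := H.differentiableAt _ (mul_pos (hpos t ht) (norm_pos_iff.2 hP))
    simpa using ((hd.hasDerivAt.comp t ((hasDerivAt_id t).mul_const ‖P‖)).sub_const
      (h (e * ‖P‖))).const_mul c₁
  have := image_norm_le_of_norm_deriv_right_le_deriv_boundary'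
    (fun t ht => (hf t ht).continuousAt.continuousWithinAt)
    (fun t ht => (hf t (Ico_subset_Icc_self ht)).hasDerivWithinAt) (by simp)
    (fun t ht => (hB t ht).continuousAt.continuousWithinAt)
    (fun t ht => (hB t (Ico_subset_Icc_self ht)).hasDerivWithinAt)
    (fun t ht => by
      have ht := hpos t (Ico_subset_Icc_self ht)
      have hu := hA.upper _ (smul_ne_zero ht.ne' hP)
      rw [norm_smul, Real.norm_of_nonneg ht.le] at hu
      rw [← mul_assoc]
      exact ContinuousLinearMap.le_of_opNorm_le _ hu P)
    (right_mem_Icc.2 he.2)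
  simpa using this

theorem norm_map_le (H : IsPowerLike h a b) (hA : HasStructure h c₀ c₁ A) {P : V} {M : ℝ}
    (hM : 0 < M) (hPM : ‖P‖ ≤ M) : ‖A P‖ ≤ c₁ * h M := by
  have hc₁ := hA.c₁_nonneg
  rcases eq_or_ne P 0 with rfl | hP
  · rw [hA.map_zero, norm_zero]
    exact mul_nonneg hc₁ (H.pos M hM).le
  have hP' := norm_pos_iff.2 hP
  have hlim : Tendsto (fun e : ℝ => ‖A P - A (e • P)‖) (𝓝[>] 0) (𝓝 ‖A P‖) := by
    have hc : Continuous fun e : ℝ => ‖A P - A (e • P)‖ :=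
      (continuous_const.sub (hA.continuous.comp (by fun_prop))).norm
    simpa [hA.map_zero] using (hc.tendsto 0).mono_left nhdsWithin_le_nhds
  refine le_of_tendsto hlim ?_
  filter_upwards [Ioc_mem_nhdsGT (zero_lt_one (α := ℝ))] with e he
  refine (hA.norm_sub_map_smul_le H hP he).trans ?_
  gcongr
  linarith [H.pos _ (mul_pos he.1 hP'), H.monotoneOn hP' hM hPM]

theorem norm_sub_le_of_dist_le (H : IsPowerLike h a b) (hA : HasStructure h c₀ c₁ A) {P Q : V}
    (hP : 0 < ‖P‖) (hPQ : ‖Q‖ ≤ ‖P‖) (hdist : ‖P - Q‖ ≤ ‖P‖ / 2) :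
    ‖A P - A Q‖ ≤ c₁ * (4 * b * weight h P Q) * ‖P - Q‖ := by
  set S : Set V := Metric.closedBall P (‖P‖ / 2) ∩ Metric.closedBall 0 ‖P‖
  have hM : 0 < ‖P‖ + ‖Q‖ := by positivity
  have hS : ∀ x ∈ S, (‖P‖ + ‖Q‖) / 4 ≤ ‖x‖ ∧ ‖x‖ ≤ ‖P‖ + ‖Q‖ := by
    rintro x ⟨hxP, hx⟩
    rw [mem_closedBall_iff_norm'] at hxP
    rw [mem_closedBall_zero_iff] at hx
    constructor <;> linarith [norm_sub_norm_le P x, norm_nonneg Q]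
  have hS0 : ∀ x ∈ S, x ≠ 0 := fun x hx =>
    norm_pos_iff.1 ((div_pos hM four_pos).trans_le (hS x hx).1)
  refine ((convex_closedBall P _).inter (convex_closedBall 0 _)).norm_image_sub_le_of_norm_fderiv_le
    (𝕜 := ℝ) (fun x hx => hA.differentiableAt x (hS0 x hx)) (fun x hx => ?_) ?_ ?_
  · exact (hA.upper x (hS0 x hx)).trans
      (mul_le_mul_of_nonneg_left (H.deriv_le hM (hS x hx).1 (hS x hx).2) hA.c₁_nonneg)
  · exact ⟨mem_closedBall_iff_norm'.2 hdist, mem_closedBall_zero_iff.2 hPQ⟩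
  · exact ⟨Metric.mem_closedBall_self (by positivity), mem_closedBall_zero_iff.2 le_rfl⟩

theorem norm_sub_le_of_le_dist (H : IsPowerLike h a b) (hA : HasStructure h c₀ c₁ A) {P Q : V}
    (hP : 0 < ‖P‖) (hPQ : ‖Q‖ ≤ ‖P‖) (hdist : ‖P‖ / 2 ≤ ‖P - Q‖) :
    ‖A P - A Q‖ ≤ 8 * c₁ * weight h P Q * ‖P - Q‖ := by
  have hM : 0 < ‖P‖ + ‖Q‖ := by positivity
  have hAP := hA.norm_map_le H hM (le_add_of_nonneg_right (norm_nonneg Q) : ‖P‖ ≤ _)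
  have hAQ := hA.norm_map_le H hM (le_add_of_nonneg_left (norm_nonneg P) : ‖Q‖ ≤ _)
  have hc₁ := hA.c₁_nonneg
  have hw := weight_nonneg H P Q
  calc ‖A P - A Q‖ ≤ ‖A P‖ + ‖A Q‖ := norm_sub_le _ _
    _ ≤ 2 * c₁ * h (‖P‖ + ‖Q‖) := by linarith
    _ = 2 * c₁ * weight h P Q * (‖P‖ + ‖Q‖) := by
        rw [weight]
        field_simp
    _ ≤ 2 * c₁ * weight h P Q * (4 * ‖P - Q‖) := by
        gcongr
        linarith
    _ = 8 * c₁ * weight h P Q * ‖P - Q‖ := by ring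

theorem norm_sub_le_of_norm_le (H : IsPowerLike h a b) (hA : HasStructure h c₀ c₁ A) {P Q : V}
    (hPQ : ‖Q‖ ≤ ‖P‖) : ‖A P - A Q‖ ≤ 4 * c₁ * (b + 2) * weight h P Q * ‖P - Q‖ := by
  rcases (norm_nonneg P).eq_or_lt' with hP | hP
  · rw [hP, norm_le_zero_iff] at hPQ
    simp [norm_eq_zero.1 hP, hPQ]
  have hw := mul_nonneg (weight_nonneg H P Q) (norm_nonneg (P - Q))
  have hb := mul_nonneg (mul_nonneg hA.c₁_nonneg H.b_pos.le) hw
  have hc := mul_nonneg hA.c₁_nonneg hw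
  rcases le_total ‖P - Q‖ (‖P‖ / 2) with hdist | hdist
  · linarith [hA.norm_sub_le_of_dist_le H hP hPQ hdist]
  · linarith [hA.norm_sub_le_of_le_dist H hP hPQ hdist]

theorem isWeightedMonotone (H : IsPowerLike h a b) (hA : HasStructure h c₀ c₁ A) :
    IsWeightedMonotone h (c₀ * a * (4 ^ b)⁻¹ / 4) (4 * c₁ * (b + 2)) A where
  k_pos := by
    have := hA.c₀_pos
    have := H.a_pos
    positivity
  lower P Q := by
    rcases le_total ‖Q‖ ‖P‖ with hPQ | hPQ
    · exact hA.le_inner_of_norm_le H hPQ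
    · have := hA.le_inner_of_norm_le H hPQ
      rwa [weight_comm, norm_sub_rev, ← neg_sub (A P), ← neg_sub P, inner_neg_neg] at this
  upper P Q := by
    rcases le_total ‖Q‖ ‖P‖ with hPQ | hPQ
    · exact hA.norm_sub_le_of_norm_le H hPQ
    · have := hA.norm_sub_le_of_norm_le H hPQ
      rwa [weight_comm, norm_sub_rev, norm_sub_rev Q] at this

end HasStructure

end Monotone

/-! ### Radial operators -/

section Radial

variable {V : Type*} [NormedAddCommGroup V] [InnerProductSpace ℝ V] {h : ℝ → ℝ} {a b : ℝ}

/-- The operator `Q ↦ h(|Q|) Q / |Q|`, with value `0` at `0`. -/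
def radial (h : ℝ → ℝ) (Q : V) : V := (h ‖Q‖ / ‖Q‖) • Q

theorem norm_radial (H : IsPowerLike h a b) {Q : V} (hQ : Q ≠ 0) : ‖radial h Q‖ = h ‖Q‖ := by
  have hQ' := norm_pos_iff.2 hQ
  rw [radial, norm_smul, norm_div, norm_norm, div_mul_cancel₀ _ hQ'.ne',
    Real.norm_of_nonneg (H.pos _ hQ').le]

theorem hasFDerivAt_norm_of_ne {Q : V} (hQ : Q ≠ 0) :
    HasFDerivAt (fun x : V => ‖x‖) (innerSL ℝ (‖Q‖⁻¹ • Q)) Q := by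
  have hd := (hasStrictFDerivAt_norm_sq Q).hasFDerivAt.sqrt (pow_pos (norm_pos_iff.2 hQ) 2).ne'
  simp only [Real.sqrt_sq (norm_nonneg _)] at hd
  refine hd.congr_fderiv ?_
  ext y
  simp only [one_div, mul_inv_rev, smul_apply, innerSL_apply_apply, nsmul_eq_mul, Nat.cast_ofNat,
    smul_eq_mul, map_smul]
  field_simp

theorem hasFDerivAt_radial (H : IsPowerLike h a b) {Q : V} (hQ : Q ≠ 0) :
    HasFDerivAt (radial h) ((h ‖Q‖ / ‖Q‖) • ContinuousLinearMap.id ℝ V +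
      (deriv h ‖Q‖ - h ‖Q‖ / ‖Q‖) • (innerSL ℝ (‖Q‖⁻¹ • Q)).smulRight (‖Q‖⁻¹ • Q)) Q := by
  have hQ' := norm_pos_iff.2 hQ
  have hd := (H.differentiableAt _ hQ').hasDerivAt.div (hasDerivAt_id _) hQ'.ne'
  refine ((hd.comp_hasFDerivAt Q (hasFDerivAt_norm_of_ne hQ)).smul
    (hasFDerivAt_id Q)).congr_fderiv ?_
  ext y
  simp only [Function.comp_apply, Pi.div_apply, id_eq, mul_one, map_smul, smul_smul, add_apply,
    smul_apply, ContinuousLinearMap.id_apply, ContinuousLinearMap.smulRight_apply,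
    innerSL_apply_apply, smul_eq_mul]
  congr 2
  field_simp

theorem continuous_radial (H : IsPowerLike h a b) : Continuous (radial h : V → V) := by
  rw [continuous_iff_continuousAt]
  intro Q
  rcases eq_or_ne Q 0 with rfl | hQ
  · rw [ContinuousAt, radial, smul_zero, Metric.tendsto_nhds]
    intro ε hε
    obtain ⟨δ, hδ, hlt⟩ := Metric.tendsto_nhdsWithin_nhds.1 H.tendsto_zero ε hε
    filter_upwards [Metric.ball_mem_nhds (0 : V) hδ] with x hx
    rcases eq_or_ne x 0 with rfl | hx0
    · simpa [radial] using hε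
    · have := hlt (mem_Ioi.2 (norm_pos_iff.2 hx0)) (by simpa using hx)
      rw [dist_zero_right] at this ⊢
      rw [norm_radial H hx0]
      exact (le_abs_self _).trans_lt this
  · exact (hasFDerivAt_radial H hQ).continuousAt

theorem le_inner_fderiv_radial (H : IsPowerLike h a b) {Q : V} (hQ : Q ≠ 0) (P : V) :
    min 1 b⁻¹ * deriv h ‖Q‖ * ‖P‖ ^ 2 ≤ inner ℝ (fderiv ℝ (radial h) Q P) P := by
  have hQ' := norm_pos_iff.2 hQ
  have hd := H.deriv_pos hQ'
  set e := ‖Q‖⁻¹ • Q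
  have he : ‖e‖ = 1 := norm_smul_inv_norm (𝕜 := ℝ) hQ
  have heP : inner ℝ e P = ‖Q‖⁻¹ * inner ℝ Q P := real_inner_smul_left Q P _
  have hcs : inner ℝ e P ^ 2 ≤ ‖P‖ ^ 2 :=
    sq_le_sq.2 (by simpa [he] using abs_real_inner_le_norm e P)
  have htangential : min 1 b⁻¹ * deriv h ‖Q‖ ≤ h ‖Q‖ / ‖Q‖ := by
    refine (mul_le_mul_of_nonneg_right (min_le_right _ _) hd.le).trans ?_
    rw [inv_mul_le_iff₀ H.b_pos, ← mul_div_assoc, le_div_iff₀ hQ']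
    exact H.upper _ hQ'
  have hradial : min 1 b⁻¹ * deriv h ‖Q‖ ≤ deriv h ‖Q‖ :=
    mul_le_of_le_one_left hd.le (min_le_left _ _)
  calc min 1 b⁻¹ * deriv h ‖Q‖ * ‖P‖ ^ 2
      = min 1 b⁻¹ * deriv h ‖Q‖ * (‖P‖ ^ 2 - inner ℝ e P ^ 2) +
        min 1 b⁻¹ * deriv h ‖Q‖ * inner ℝ e P ^ 2 := by ring
    _ ≤ h ‖Q‖ / ‖Q‖ * (‖P‖ ^ 2 - inner ℝ e P ^ 2) + deriv h ‖Q‖ * inner ℝ e P ^ 2 :=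
      add_le_add (mul_le_mul_of_nonneg_right htangential (sub_nonneg.2 hcs))
        (mul_le_mul_of_nonneg_right hradial (sq_nonneg _))
    _ = inner ℝ (fderiv ℝ (radial h) Q P) P := by
      rw [(hasFDerivAt_radial H hQ).fderiv]
      simp only [add_apply, smul_apply, ContinuousLinearMap.id_apply,
        ContinuousLinearMap.smulRight_apply, innerSL_apply_apply, inner_add_left,
        real_inner_smul_left, real_inner_self_eq_norm_sq, heP]
      ring

theorem norm_fderiv_radial_le (H : IsPowerLike h a b) {Q : V} (hQ : Q ≠ 0) :
    ‖fderiv ℝ (radial h) Q‖ ≤ (2 * a⁻¹ + 1) * deriv h ‖Q‖ := by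
  have hQ' := norm_pos_iff.2 hQ
  have hd := H.deriv_pos hQ'
  have hquot : 0 ≤ h ‖Q‖ / ‖Q‖ := (div_pos (H.pos _ hQ') hQ').le
  have hle : h ‖Q‖ / ‖Q‖ ≤ a⁻¹ * deriv h ‖Q‖ := by
    rw [div_le_iff₀ hQ', mul_assoc, le_inv_mul_iff₀ H.a_pos]
    exact H.lower _ hQ'
  rw [(hasFDerivAt_radial H hQ).fderiv]
  calc ‖_‖ ≤ h ‖Q‖ / ‖Q‖ * 1 + (deriv h ‖Q‖ + h ‖Q‖ / ‖Q‖) * (1 * 1) := by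
        refine (norm_add_le _ _).trans (add_le_add ?_ ?_)
        · rw [norm_smul, Real.norm_of_nonneg hquot]
          exact mul_le_mul_of_nonneg_left ContinuousLinearMap.norm_id_le hquot
        · rw [norm_smul, ContinuousLinearMap.norm_smulRight_apply, innerSL_apply_norm,
            show ‖‖Q‖⁻¹ • Q‖ = 1 from norm_smul_inv_norm (𝕜 := ℝ) hQ]
          gcongr
          exact (norm_sub_le _ _).trans_eq
            (by rw [Real.norm_of_nonneg hd.le, Real.norm_of_nonneg hquot])
    _ ≤ (2 * a⁻¹ + 1) * deriv h ‖Q‖ := by linarith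

theorem hasStructure_radial (H : IsPowerLike h a b) :
    HasStructure h (min 1 b⁻¹) (2 * a⁻¹ + 1) (radial h : V → V) where
  c₀_pos := lt_min one_pos (inv_pos.2 H.b_pos)
  c₁_nonneg := by linarith [inv_pos.2 H.a_pos]
  continuous := continuous_radial H
  map_zero := smul_zero _
  differentiableAt _ hQ := (hasFDerivAt_radial H hQ).differentiableAt
  lower P _ hQ := le_inner_fderiv_radial H hQ P
  upper _ hQ := norm_fderiv_radial_le H hQ

end Radial

/-! ### Natural distance and quasi-optimality -/

section NaturalMap

variable {V : Type*} [NormedAddCommGroup V] [InnerProductSpace ℝ V]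

/-- `F` measures the natural distance of the monotone operator `A`: `|F(P) - F(Q)|²` is controlled
by `(A(P) - A(Q)) : (P - Q)`, and pairings with `A(P) - A(Q)` satisfy a Young inequality. -/
structure IsNaturalMap (A F : V → V) (K₁ K₂ : ℝ) : Prop where
  K₁_nonneg : 0 ≤ K₁
  K₂_nonneg : 0 ≤ K₂
  coercive : ∀ P Q, ‖F P - F Q‖ ^ 2 ≤ K₁ * inner ℝ (A P - A Q) (P - Q)
  young : ∀ P Q R, inner ℝ (A P - A Q) (P - R) ≤
    1 / 2 * inner ℝ (A P - A Q) (P - Q) + K₂ * ‖F P - F R‖ ^ 2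

namespace IsWeightedMonotone

variable {h : ℝ → ℝ} {a b k K kF KF l : ℝ} {A F : V → V}

theorem norm_sub_sq_le (H : IsPowerLike h a b) (hA : IsWeightedMonotone h k K A)
    (hF : IsWeightedMonotone (fun t => √(h t * t)) kF KF F) (P Q : V) :
    ‖F P - F Q‖ ^ 2 ≤ KF ^ 2 / k * inner ℝ (A P - A Q) (P - Q) := by
  calc ‖F P - F Q‖ ^ 2 ≤ (KF * weight (fun t => √(h t * t)) P Q * ‖P - Q‖) ^ 2 :=
        pow_le_pow_left₀ (norm_nonneg _) (hF.upper P Q) 2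
    _ = KF ^ 2 / k * (k * weight h P Q * ‖P - Q‖ ^ 2) := by
        have := hA.k_pos
        rw [mul_pow, mul_pow, weight_sqrt_mul_id_sq H]
        field_simp
    _ ≤ KF ^ 2 / k * inner ℝ (A P - A Q) (P - Q) := by
        have := hA.k_pos
        gcongr
        exact hA.lower P Q

theorem weight_mul_sq_le (H : IsPowerLike h a b)
    (hF : IsWeightedMonotone (fun t => √(h t * t)) kF KF F) (P Q : V) :
    weight h P Q * ‖P - Q‖ ^ 2 ≤ ‖F P - F Q‖ ^ 2 / kF ^ 2 := by
  have hk := hF.k_pos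
  have hle : (weight (fun t => √(h t * t)) P Q * ‖P - Q‖) ^ 2 ≤ (‖F P - F Q‖ / kF) ^ 2 := by
    have := weight_nonneg H.sqrt_mul_id P Q
    refine pow_le_pow_left₀ (by positivity) ?_ 2
    rw [le_div_iff₀' hk, ← mul_assoc]
    exact hF.le_norm_sub P Q
  rwa [mul_pow, div_pow, weight_sqrt_mul_id_sq H] at hle

theorem inner_sub_le (H : IsPowerLike h a b) (hA : IsWeightedMonotone h k K A)
    (hF : IsWeightedMonotone (fun t => √(h t * t)) kF KF F) (hl : 1 ≤ l) (hlK : 2 * K ≤ k * l)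
    (P Q R : V) :
    inner ℝ (A P - A Q) (P - R) ≤ 1 / 2 * inner ℝ (A P - A Q) (P - Q) +
      k * l / 2 * (3 * l * (3 * l) ^ b) / kF ^ 2 * ‖F P - F R‖ ^ 2 := by
  have hk := hA.k_pos
  have : 0 < l := one_pos.trans_le hl
  have hwPQ := weight_nonneg H P Q
  have hmon : 0 ≤ inner ℝ (A P - A Q) (P - Q) := (by positivity : (0 : ℝ) ≤ _).trans (hA.lower P Q)
  have hcs : inner ℝ (A P - A Q) (P - R) ≤
      k / 2 * (weight h P Q * ‖P - Q‖) * (l * ‖P - R‖) := by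
    calc inner ℝ (A P - A Q) (P - R) ≤ K * weight h P Q * ‖P - Q‖ * ‖P - R‖ :=
          (real_inner_le_norm _ _).trans
            (mul_le_mul_of_nonneg_right (hA.upper P Q) (norm_nonneg _))
      _ ≤ k * l / 2 * weight h P Q * ‖P - Q‖ * ‖P - R‖ := by
          gcongr
          linarith
      _ = k / 2 * (weight h P Q * ‖P - Q‖) * (l * ‖P - R‖) := by ring
  rcases le_total (l * ‖P - R‖) ‖P - Q‖ with hc | hc
  · calc inner ℝ (A P - A Q) (P - R) ≤ k / 2 * (weight h P Q * ‖P - Q‖) * ‖P - Q‖ :=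
          hcs.trans (by gcongr)
      _ = 1 / 2 * (k * weight h P Q * ‖P - Q‖ ^ 2) := by ring
      _ ≤ 1 / 2 * inner ℝ (A P - A Q) (P - Q) := by
          gcongr
          exact hA.lower P Q
      _ ≤ _ := le_add_of_nonneg_right (by positivity)
  · calc inner ℝ (A P - A Q) (P - R)
        ≤ k / 2 * (3 * l * (3 * l) ^ b * (weight h P R * ‖P - R‖)) * (l * ‖P - R‖) :=
          hcs.trans (by gcongr k / 2 * ?_ * _; exact weight_change_of_shift H hl hc)
      _ = k * l / 2 * (3 * l * (3 * l) ^ b) * (weight h P R * ‖P - R‖ ^ 2) := by ring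
      _ ≤ k * l / 2 * (3 * l * (3 * l) ^ b) * (‖F P - F R‖ ^ 2 / kF ^ 2) := by
          gcongr
          exact hF.weight_mul_sq_le H P R
      _ = k * l / 2 * (3 * l * (3 * l) ^ b) / kF ^ 2 * ‖F P - F R‖ ^ 2 := by ring
      _ ≤ _ := le_add_of_nonneg_left (by positivity)

theorem isNaturalMap (H : IsPowerLike h a b) (hA : IsWeightedMonotone h k K A)
    (hF : IsWeightedMonotone (fun t => √(h t * t)) kF KF F) (hl : 1 ≤ l) (hlK : 2 * K ≤ k * l) :
    IsNaturalMap A F (KF ^ 2 / k) (k * l / 2 * (3 * l * (3 * l) ^ b) / kF ^ 2) where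
  K₁_nonneg := div_nonneg (sq_nonneg _) hA.k_pos.le
  K₂_nonneg := by
    have := hA.k_pos
    positivity
  coercive := hA.norm_sub_sq_le H hF
  young := hA.inner_sub_le H hF hl hlK

end IsWeightedMonotone

theorem eLpNorm_two_le_of_integral_sq_le {α X Y : Type*} [MeasurableSpace α] {μ : Measure α}
    [NormedAddCommGroup X] [NormedAddCommGroup Y] {f : α → X} {g : α → Y} (hf : MemLp f 2 μ)
    (hg : MemLp g 2 μ) {K : ℝ} (hK : 0 ≤ K)
    (h : ∫ x, ‖f x‖ ^ 2 ∂μ ≤ K * ∫ x, ‖g x‖ ^ 2 ∂μ) :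
    eLpNorm f 2 μ ≤ ENNReal.ofReal √K * eLpNorm g 2 μ := by
  rw [hf.eLpNorm_eq_integral_rpow_norm two_ne_zero ENNReal.ofNat_ne_top,
    hg.eLpNorm_eq_integral_rpow_norm two_ne_zero ENNReal.ofNat_ne_top,
    ← ENNReal.ofReal_mul (Real.sqrt_nonneg K)]
  simp only [ENNReal.toReal_ofNat, Real.rpow_ofNat]
  rw [← one_div, ← Real.sqrt_eq_rpow, ← Real.sqrt_eq_rpow, ← Real.sqrt_mul hK]
  exact ENNReal.ofReal_le_ofReal (Real.sqrt_le_sqrt h)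

/-- Céa's lemma in the natural distance. -/
theorem IsNaturalMap.eLpNorm_sub_le {α : Type*} [MeasurableSpace α] {μ : Measure α} {A F : V → V}
    {K₁ K₂ : ℝ} (hAF : IsNaturalMap A F K₁ K₂) {P Q R : α → V}
    (hPQ : Integrable (fun x => inner ℝ (A (P x) - A (Q x)) (P x - Q x)) μ)
    (hPR : Integrable (fun x => inner ℝ (A (P x) - A (Q x)) (P x - R x)) μ)
    (hFQ : MemLp (fun x => F (P x) - F (Q x)) 2 μ) (hFR : MemLp (fun x => F (P x) - F (R x)) 2 μ)
    (horth : ∫ x, inner ℝ (A (P x) - A (Q x)) (Q x - R x) ∂μ = 0) :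
    eLpNorm (fun x => F (P x) - F (Q x)) 2 μ ≤
      ENNReal.ofReal √(K₁ * (2 * K₂)) * eLpNorm (fun x => F (P x) - F (R x)) 2 μ := by
  have hK₁ := hAF.K₁_nonneg
  have hswap : ∫ x, inner ℝ (A (P x) - A (Q x)) (P x - Q x) ∂μ =
      ∫ x, inner ℝ (A (P x) - A (Q x)) (P x - R x) ∂μ := by
    rw [← sub_eq_zero, ← neg_eq_zero, neg_sub, ← integral_sub hPR hPQ, ← horth]
    simp only [← inner_sub_right, sub_sub_sub_cancel_left]
  have hcoercive : ∫ x, ‖F (P x) - F (Q x)‖ ^ 2 ∂μ ≤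
      K₁ * ∫ x, inner ℝ (A (P x) - A (Q x)) (P x - Q x) ∂μ := by
    rw [← integral_const_mul]
    exact integral_mono hFQ.norm.integrable_sq (hPQ.const_mul K₁) fun x => hAF.coercive _ _
  have hyoung : ∫ x, inner ℝ (A (P x) - A (Q x)) (P x - R x) ∂μ ≤
      1 / 2 * ∫ x, inner ℝ (A (P x) - A (Q x)) (P x - Q x) ∂μ +
        K₂ * ∫ x, ‖F (P x) - F (R x)‖ ^ 2 ∂μ := by
    rw [← integral_const_mul, ← integral_const_mul, ← integral_add (hPQ.const_mul _)
      (hFR.norm.integrable_sq.const_mul _)]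
    exact integral_mono hPR ((hPQ.const_mul _).add (hFR.norm.integrable_sq.const_mul _))
      fun x => hAF.young _ _ _
  refine eLpNorm_two_le_of_integral_sq_le hFQ hFR (by have := hAF.K₂_nonneg; positivity) ?_
  rw [mul_assoc]
  exact hcoercive.trans (mul_le_mul_of_nonneg_left (by linarith) hK₁)

end NaturalMap

/-! ### Operators with `φ`-structure -/

theorem IsUniformlyConvexNFunction.isPowerLike {φ : ℝ → ℝ} {rm rp : ℝ}
    (hφ : IsUniformlyConvexNFunction φ rm rp) : IsPowerLike (deriv φ) (rm - 1) (rp - 1) := by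
  have hl : ∀ t, 0 < t → rm ≤ deriv (deriv φ) t * t / deriv φ t + 1 := fun t ht =>
    hφ.isGLB.1 (mem_image_of_mem _ ht)
  have hu : ∀ t, 0 < t → deriv (deriv φ) t * t / deriv φ t + 1 ≤ rp := fun t ht =>
    hφ.isLUB.1 (mem_image_of_mem _ ht)
  have hpos : ∀ t, 0 < t → 0 < deriv φ t := fun t ht => by
    refine lt_of_le_of_ne ?_ fun h0 => ?_
    · rw [← derivWithin_of_mem_nhds (Ici_mem_nhds ht)]
      exact hφ.isNFunction.strictMonoOn.monotoneOn.derivWithin_nonneg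
    · -- if `φ' t` were zero, then so would be the junk quotient `φ'' t * t / φ' t`
      have := hl t ht
      rw [← h0, div_zero, zero_add] at this
      linarith [hφ.one_lt]
  have hd : ContDiffOn ℝ 1 (deriv φ) (Ioi 0) :=
    hφ.contDiffOn.deriv_of_isOpen isOpen_Ioi (by norm_num)
  exact
    { a_pos := sub_pos.2 hφ.one_lt
      differentiableAt := fun t ht =>
        (hd.differentiableOn one_ne_zero).differentiableAt (Ioi_mem_nhds ht)
      pos := hpos
      lower := fun t ht => (le_div_iff₀ (hpos t ht)).1 (by linarith [hl t ht])
      upper := fun t ht => (div_le_iff₀ (hpos t ht)).1 (by linarith [hu t ht]) }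

theorem opNorm_le_card_mul_of_abs_apply_single_le {ι : Type*} [Fintype ι] [DecidableEq ι]
    {L : EuclideanSpace ℝ ι →L[ℝ] EuclideanSpace ℝ ι} {c : ℝ} (hc : 0 ≤ c)
    (hL : ∀ p q, |L (EuclideanSpace.single q 1) p| ≤ c) : ‖L‖ ≤ Fintype.card ι * c := by
  refine L.opNorm_le_bound (by positivity) fun x => ?_
  have hx : (∑ q, |x q|) ^ 2 ≤ Fintype.card ι * ‖x‖ ^ 2 := by
    simpa only [sq_abs, EuclideanSpace.real_norm_sq_eq, Finset.card_univ] using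
      sq_sum_le_card_mul_sum_sq (s := Finset.univ) (f := fun q => |x q|)
  have hentry : ∀ p, |L x p| ≤ c * ∑ q, |x q| := fun p => by
    have hexp : L x p = ∑ q, x q * L (EuclideanSpace.single q 1) p := by
      conv_lhs => rw [← (EuclideanSpace.basisFun ι ℝ).sum_repr x]
      simp [map_sum]
    rw [hexp, Finset.mul_sum]
    refine (Finset.abs_sum_le_sum_abs _ _).trans (Finset.sum_le_sum fun q _ => ?_)
    rw [abs_mul, mul_comm]
    gcongr
    exact hL p q
  refine le_of_sq_le_sq ?_ (by positivity)
  calc ‖L x‖ ^ 2 = ∑ p, |L x p| ^ 2 := by simp only [EuclideanSpace.real_norm_sq_eq, sq_abs]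
    _ ≤ ∑ _p : ι, (c * ∑ q, |x q|) ^ 2 := by gcongr; exact hentry _
    _ = Fintype.card ι * (c ^ 2 * (∑ q, |x q|) ^ 2) := by
        rw [Finset.sum_const, Finset.card_univ, nsmul_eq_mul, mul_pow]
    _ ≤ Fintype.card ι * (c ^ 2 * (Fintype.card ι * ‖x‖ ^ 2)) := by gcongr
    _ = (Fintype.card ι * c * ‖x‖) ^ 2 := by ring

theorem HasPhiStructure.hasStructure {d : ℕ} {φ : ℝ → ℝ} {C₀ C₁ a b : ℝ}
    {A : Mat d → Mat d} (hA : HasPhiStructure φ C₀ C₁ A) (H : IsPowerLike (deriv φ) a b) :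
    HasStructure (deriv φ) C₀ (d ^ 2 * C₁) A where
  c₀_pos := hA.C₀_pos
  c₁_nonneg := mul_nonneg (by positivity) hA.C₁_pos.le
  continuous := hA.continuous
  map_zero := hA.map_zero
  differentiableAt Q hQ := (hA.contDiffOn.differentiableOn one_ne_zero).differentiableAt
    (isOpen_compl_singleton.mem_nhds hQ)
  lower P Q hQ := by
    refine (hA.coercive P Q hQ).trans_eq ?_
    have hexp : ∀ p, fderiv ℝ A Q P p = ∑ k, ∑ l, P (k, l) * fderiv ℝ A Q (unitMat k l) p :=
      fun p => by
        conv_lhs => rw [← (EuclideanSpace.basisFun (Fin d × Fin d) ℝ).sum_repr P]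
        simp [unitMat, map_sum, Fintype.sum_prod_type]
    simp only [PiLp.inner_apply, Fintype.sum_prod_type, hexp, RCLike.inner_apply, conj_trivial,
      Finset.mul_sum]
    exact Finset.sum_congr rfl fun i _ => Finset.sum_congr rfl fun j _ =>
      Finset.sum_congr rfl fun k _ => Finset.sum_congr rfl fun l _ => by ring
  upper Q hQ := by
    refine (opNorm_le_card_mul_of_abs_apply_single_le (c := C₁ * deriv (deriv φ) ‖Q‖) ?_
      fun p q => hA.bounded Q hQ p.1 p.2 q.1 q.2).trans_eq ?_
    · exact mul_nonneg hA.C₁_pos.le (H.deriv_pos (norm_pos_iff.2 hQ)).le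
    · simp only [Fintype.card_prod, Fintype.card_fin, Nat.cast_mul]
      ring

theorem HasStructure.mono {V : Type*} [NormedAddCommGroup V] [InnerProductSpace ℝ V] {h : ℝ → ℝ}
    {a b c₀ c₁ c : ℝ} {A : V → V} (H : IsPowerLike h a b) (hA : HasStructure h c₀ c₁ A)
    (hc : c₁ ≤ c) : HasStructure h c₀ c A :=
  { hA with
    c₁_nonneg := hA.c₁_nonneg.trans hc
    upper := fun Q hQ => (hA.upper Q hQ).trans <|
      mul_le_mul_of_nonneg_right hc (H.deriv_pos (norm_pos_iff.2 hQ)).le }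

/-! ### Integrability in Orlicz classes -/

section Orlicz

variable {d : ℕ} {φ : ℝ → ℝ} {rm rp : ℝ} {Ω : Set (Vec d)}

theorem IsNFunction.nonneg (hφ : IsNFunction φ) {t : ℝ} (ht : 0 ≤ t) : 0 ≤ φ t :=
  hφ.map_zero ▸ hφ.strictMonoOn.monotoneOn self_mem_Ici ht ht

theorem IsUniformlyConvexNFunction.deriv_mul_le (hφ : IsUniformlyConvexNFunction φ rm rp) {t : ℝ}
    (ht : 0 ≤ t) : deriv φ t * t ≤ 2 * 2 ^ (rp - 1) * φ t := by
  rcases ht.eq_or_lt with rfl | ht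
  · simp [hφ.isNFunction.map_zero]
  have ht2 : 0 < t / 2 := half_pos ht
  have hslope : deriv φ (t / 2) * (t - t / 2) ≤ φ t := by
    have h := hφ.isNFunction.convexOn.deriv_le_slope (mem_Ici.2 ht2.le) (mem_Ici.2 ht.le)
      (half_lt_self ht)
      ((hφ.contDiffOn.differentiableOn two_ne_zero).differentiableAt (Ioi_mem_nhds ht2))
    rw [slope_def_field, le_div_iff₀ (by linarith)] at h
    linarith [hφ.isNFunction.nonneg ht2.le]
  have hdouble : deriv φ t ≤ 2 ^ (rp - 1) * deriv φ (t / 2) := by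
    simpa only [mul_div_cancel₀ t two_ne_zero] using
      hφ.isPowerLike.map_mul_le (l := 2) one_le_two ht2
  calc deriv φ t * t ≤ 2 ^ (rp - 1) * deriv φ (t / 2) * t := by gcongr
    _ = 2 * 2 ^ (rp - 1) * (deriv φ (t / 2) * (t - t / 2)) := by ring
    _ ≤ 2 * 2 ^ (rp - 1) * φ t := by gcongr

theorem MemLPhi.integrable (hφ : IsNFunction φ) {X : Type*} [NormedAddCommGroup X]
    {g : Vec d → X} (hg : MemLPhi φ Ω g) : IntegrableOn (fun x => φ ‖g x‖) Ω := by
  have hc : Continuous fun x : X => φ ‖x‖ :=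
    hφ.continuousOn.comp_continuous continuous_norm fun x => norm_nonneg x
  refine ⟨hc.comp_aestronglyMeasurable hg.1, ?_⟩
  rw [hasFiniteIntegral_iff_ofReal (Eventually.of_forall fun x => hφ.nonneg (norm_nonneg _))]
  exact hg.2

theorem MemLPhi.mono (hφ : IsNFunction φ) {X Y : Type*} [NormedAddCommGroup X]
    [NormedAddCommGroup Y] {f : Vec d → X} {g : Vec d → Y} (hg : MemLPhi φ Ω g)
    (hf : AEStronglyMeasurable f (volume.restrict Ω))
    (hfg : ∀ᵐ x ∂volume.restrict Ω, ‖f x‖ ≤ ‖g x‖) : MemLPhi φ Ω f := by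
  refine ⟨hf, (lintegral_mono_ae ?_).trans_lt hg.2⟩
  filter_upwards [hfg] with x hx
  exact ENNReal.ofReal_le_ofReal <|
    hφ.strictMonoOn.monotoneOn (norm_nonneg _) (norm_nonneg _) hx

theorem memLPhi_of_memLp_top (hφ : IsNFunction φ) (hΩ : volume Ω ≠ ⊤) {X : Type*}
    [NormedAddCommGroup X] {g : Vec d → X} (hg : MemLp g ⊤ (volume.restrict Ω)) :
    MemLPhi φ Ω g := by
  have hconst : MemLPhi φ Ω fun _ => lpNorm g ⊤ (volume.restrict Ω) := by
    refine ⟨aestronglyMeasurable_const, ?_⟩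
    rw [setLIntegral_const]
    exact ENNReal.mul_lt_top ENNReal.ofReal_lt_top hΩ.lt_top
  refine hconst.mono hφ hg.1 ?_
  filter_upwards [ae_le_lpNorm_exponent_top hg] with x hx
  exact hx.trans (le_abs_self _)

theorem W01Infty_subset_W01Phi (hφ : IsNFunction φ) (hΩ : volume Ω ≠ ⊤) :
    (W01Infty Ω : Set (Vec d → Vec d)) ⊆ W01Phi φ Ω := by
  rintro v ⟨G, hG, hv, hGtop, htrace⟩
  exact ⟨G, hG, memLPhi_of_memLp_top hφ hΩ hv, memLPhi_of_memLp_top hφ hΩ hGtop, htrace⟩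

theorem norm_natF_sq_le (hφ : IsUniformlyConvexNFunction φ rm rp) (Q : Mat d) :
    ‖natF φ Q‖ ^ 2 ≤ 2 * 2 ^ (rp - 1) * φ ‖Q‖ := by
  have hnorm : ‖natF φ Q‖ ^ 2 = deriv φ ‖Q‖ * ‖Q‖ := by
    rcases eq_or_ne Q 0 with rfl | hQ
    · simp [natF]
    · have hradial : ‖natF φ Q‖ = √(deriv φ ‖Q‖ * ‖Q‖) :=
        norm_radial hφ.isPowerLike.sqrt_mul_id hQ
      rw [hradial, Real.sq_sqrt]
      exact mul_nonneg (hφ.isPowerLike.pos _ (norm_pos_iff.2 hQ)).le (norm_nonneg Q)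
  exact hnorm.trans_le (hφ.deriv_mul_le (norm_nonneg Q))

theorem memLp_natF (hφ : IsUniformlyConvexNFunction φ rm rp) {P : Vec d → Mat d}
    (hP : MemLPhi φ Ω P) : MemLp (fun x => natF φ (P x)) 2 (volume.restrict Ω) := by
  have hm : AEStronglyMeasurable (fun x => natF φ (P x)) (volume.restrict Ω) :=
    (continuous_radial hφ.isPowerLike.sqrt_mul_id).comp_aestronglyMeasurable hP.1
  rw [memLp_two_iff_integrable_sq_norm hm]
  refine ((hP.integrable hφ.isNFunction).const_mul (2 * 2 ^ (rp - 1))).mono' (hm.norm.pow 2)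
    (Eventually.of_forall fun x => ?_)
  rw [Real.norm_of_nonneg (sq_nonneg _)]
  exact norm_natF_sq_le hφ (P x)

theorem HasStructure.norm_inner_le {A : Mat d → Mat d} {c₀ c₁ : ℝ}
    (hφ : IsUniformlyConvexNFunction φ rm rp) (hA : HasStructure (deriv φ) c₀ c₁ A) (P Q : Mat d) :
    ‖inner ℝ (A P) Q‖ ≤ c₁ * (2 * 2 ^ (rp - 1)) * (φ ‖P‖ + φ ‖Q‖) := by
  have hc := hA.c₁_nonneg
  set M := max ‖P‖ ‖Q‖ with hM
  have hM0 : 0 ≤ M := (norm_nonneg P).trans (le_max_left _ _)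
  have hφM : φ M ≤ φ ‖P‖ + φ ‖Q‖ := by
    have hP := hφ.isNFunction.nonneg (norm_nonneg P)
    have hQ := hφ.isNFunction.nonneg (norm_nonneg Q)
    rcases max_choice ‖P‖ ‖Q‖ with h | h <;> rw [hM, h] <;> linarith
  have hAM : ‖A P‖ * M ≤ c₁ * (deriv φ M * M) := by
    rcases hM0.eq_or_lt with h0 | hpos
    · simp [← h0]
    · rw [← mul_assoc]
      exact mul_le_mul_of_nonneg_right
        (hA.norm_map_le hφ.isPowerLike hpos (le_max_left _ _)) hM0
  calc ‖inner ℝ (A P) Q‖ ≤ ‖A P‖ * ‖Q‖ := norm_inner_le_norm _ _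
    _ ≤ ‖A P‖ * M := by gcongr; exact le_max_right _ _
    _ ≤ c₁ * (deriv φ M * M) := hAM
    _ ≤ c₁ * (2 * 2 ^ (rp - 1) * (φ ‖P‖ + φ ‖Q‖)) := mul_le_mul_of_nonneg_left
        ((hφ.deriv_mul_le hM0).trans (mul_le_mul_of_nonneg_left hφM (by positivity))) hc
    _ = c₁ * (2 * 2 ^ (rp - 1)) * (φ ‖P‖ + φ ‖Q‖) := (mul_assoc _ _ _).symm

theorem HasStructure.integrable_inner {A : Mat d → Mat d} {c₀ c₁ : ℝ}
    (hφ : IsUniformlyConvexNFunction φ rm rp) (hA : HasStructure (deriv φ) c₀ c₁ A)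
    {P Q : Vec d → Mat d} (hP : MemLPhi φ Ω P) (hQ : MemLPhi φ Ω Q) :
    IntegrableOn (fun x => inner ℝ (A (P x)) (Q x)) Ω :=
  (((hP.integrable hφ.isNFunction).add (hQ.integrable hφ.isNFunction)).const_mul _).mono'
    ((hA.continuous.comp_aestronglyMeasurable hP.1).inner hQ.1)
    (Eventually.of_forall fun x => hA.norm_inner_le hφ (P x) (Q x))

theorem HasStructure.integrable_inner_sub_sub {A : Mat d → Mat d} {c₀ c₁ : ℝ}
    (hφ : IsUniformlyConvexNFunction φ rm rp) (hA : HasStructure (deriv φ) c₀ c₁ A)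
    {P Q R S : Vec d → Mat d} (hP : MemLPhi φ Ω P) (hQ : MemLPhi φ Ω Q) (hR : MemLPhi φ Ω R)
    (hS : MemLPhi φ Ω S) :
    IntegrableOn (fun x => inner ℝ (A (P x) - A (Q x)) (R x - S x)) Ω := by
  simp only [inner_sub_left, inner_sub_right]
  exact ((hA.integrable_inner hφ hP hR).sub (hA.integrable_inner hφ hQ hR)).sub
    ((hA.integrable_inner hφ hP hS).sub (hA.integrable_inner hφ hQ hS))

end Orlicz

/-! ### Weak gradients -/

section WeakGrad

variable {d : ℕ} {Ω U : Set (Vec d)} {v w : Vec d → Vec d} {G H : Vec d → Mat d}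

theorem fderiv_apply_unitVec {x : Vec d} (hw : DifferentiableAt ℝ w x) (i j : Fin d) :
    fderiv ℝ (fun y => w y i) x (unitVec j) = grad w x (i, j) :=
  congrArg (· (unitVec j))
    ((EuclideanSpace.proj (𝕜 := ℝ) i : Vec d →L[ℝ] ℝ).hasFDerivAt.comp x hw.hasFDerivAt).fderiv

theorem IsTest.apply (hv : IsTest Ω v) (i : Fin d) : IsTest Ω fun x => v x i :=
  ⟨contDiff_euclidean.1 hv.1 i, hv.2.1.comp_left (g := fun y : Vec d => y i) rfl,
    (tsupport_comp_subset (g := fun y : Vec d => y i) rfl v).trans hv.2.2⟩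

theorem setIntegral_mul_eq_integral {f χ : Vec d → ℝ} (hχ : tsupport χ ⊆ Ω) :
    ∫ x in Ω, f x * χ x = ∫ x, f x * χ x :=
  setIntegral_eq_integral_of_forall_compl_eq_zero fun x hx => by
    rw [image_eq_zero_of_notMem_tsupport fun hx' => hx (hχ hx'), mul_zero]

theorem IsTest.tsupport_fderiv_subset {ψ : Vec d → ℝ} (hψ : IsTest Ω ψ) (j : Fin d) :
    (tsupport fun x => fderiv ℝ ψ x (unitVec j)) ⊆ Ω :=
  (tsupport_fderiv_apply_subset ℝ _).trans hψ.2.2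

theorem hasWeakGrad_grad (hw : ContDiff ℝ ∞ w) : HasWeakGrad Ω w (grad w) := by
  refine ⟨hw.continuous.locallyIntegrable.locallyIntegrableOn Ω,
    (continuous_grad hw).locallyIntegrable.locallyIntegrableOn Ω, fun ψ hψ i j => ?_⟩
  have hwi : ContDiff ℝ ∞ fun x => w x i := contDiff_euclidean.1 hw i
  have hw' : Continuous fun x => fderiv ℝ (fun x => w x i) x (unitVec j) :=
    (hwi.continuous_fderiv (by simp)).clm_apply continuous_const
  have hψ' : Continuous fun x => fderiv ℝ ψ x (unitVec j) :=
    (hψ.1.continuous_fderiv (by simp)).clm_apply continuous_const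
  have hparts := integral_mul_fderiv_eq_neg_fderiv_mul_of_integrable (μ := volume)
    ((hw'.mul hψ.1.continuous).integrable_of_hasCompactSupport hψ.2.1.mul_left)
    ((hwi.continuous.mul hψ').integrable_of_hasCompactSupport
      (hψ.2.1.fderiv_apply ℝ _).mul_left)
    ((hwi.continuous.mul hψ.1.continuous).integrable_of_hasCompactSupport hψ.2.1.mul_left)
    (fun x _ => hwi.differentiable (by simp) x) (fun x _ => hψ.1.differentiable (by simp) x)
  rw [setIntegral_mul_eq_integral (hψ.tsupport_fderiv_subset j),
    setIntegral_mul_eq_integral hψ.2.2, hparts]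
  simp only [fderiv_apply_unitVec (hw.differentiable (by simp) _)]

theorem HasWeakGrad.mono (h : HasWeakGrad Ω v G) (hU : U ⊆ Ω) : HasWeakGrad U v G := by
  refine ⟨h.1.mono_set hU, h.2.1.mono_set hU, fun ψ hψ i j => ?_⟩
  have hψΩ : IsTest Ω ψ := ⟨hψ.1, hψ.2.1, hψ.2.2.trans hU⟩
  rw [setIntegral_mul_eq_integral (hψ.tsupport_fderiv_subset j),
    setIntegral_mul_eq_integral hψ.2.2,
    ← setIntegral_mul_eq_integral (hψΩ.tsupport_fderiv_subset j),
    ← setIntegral_mul_eq_integral hψΩ.2.2, h.2.2 ψ hψΩ i j]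

theorem HasWeakGrad.weakGrad (h : HasWeakGrad Ω v G) : HasWeakGrad Ω v (weakGrad Ω v) := by
  rw [NonlinearStokes.weakGrad, dif_pos ⟨G, h⟩]
  exact Exists.choose_spec _

theorem HasWeakGrad.ae_eq (hΩ : IsOpen Ω) (hG : HasWeakGrad Ω v G) (hH : HasWeakGrad Ω w H)
    (hvw : v =ᵐ[volume.restrict Ω] w) : G =ᵐ[volume.restrict Ω] H := by
  have hentry : ∀ p : Fin d × Fin d, ∀ᵐ x, x ∈ Ω → G x p - H x p = 0 := by
    rintro ⟨i, j⟩
    have hloc : LocallyIntegrableOn (fun x => G x (i, j) - H x (i, j)) Ω := fun x hx => by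
      obtain ⟨s, hs, hi⟩ := (hG.2.1.sub hH.2.1) x hx
      exact ⟨s, hs, (EuclideanSpace.proj (𝕜 := ℝ) (i, j) : Mat d →L[ℝ] ℝ).integrable_comp hi⟩
    refine hΩ.ae_eq_zero_of_integral_contDiff_smul_eq_zero hloc fun ψ hψ hc hs => ?_
    have hint : ∫ x in Ω, G x (i, j) * ψ x = ∫ x in Ω, H x (i, j) * ψ x := by
      rw [← neg_inj, ← hG.2.2 ψ ⟨hψ, hc, hs⟩ i j, ← hH.2.2 ψ ⟨hψ, hc, hs⟩ i j]
      refine integral_congr_ae ?_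
      filter_upwards [hvw] with x hx
      rw [hx]
    simp only [smul_eq_mul, mul_comm (ψ _)]
    rw [← setIntegral_mul_eq_integral hs]
    simp only [sub_mul]
    rw [integral_sub (integrableOn_mul_test hG.2.1 hψ.continuous hc hs (i, j))
      (integrableOn_mul_test hH.2.1 hψ.continuous hc hs (i, j)), hint, sub_self]
  refine (ae_restrict_iff' hΩ.measurableSet).2 ?_
  filter_upwards [ae_all_iff.2 hentry] with x hx hxΩ
  ext p
  exact sub_eq_zero.1 (hx p hxΩ)

theorem HasWeakGrad.weakGrad_ae_eq (hΩ : IsOpen Ω) (h : HasWeakGrad Ω v G) :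
    NonlinearStokes.weakGrad Ω v =ᵐ[volume.restrict Ω] G :=
  h.weakGrad.ae_eq hΩ h EventuallyEq.rfl

theorem HasWeakGrad.weakGrad_ae_eq_grad (hU : IsOpen U) (hUΩ : U ⊆ Ω) (h : HasWeakGrad Ω v G)
    (hw : ContDiff ℝ ∞ w) (hvw : EqOn v w U) :
    NonlinearStokes.weakGrad Ω v =ᵐ[volume.restrict U] grad w :=
  (h.weakGrad.mono hUΩ).ae_eq hU (hasWeakGrad_grad hw)
    (ae_restrict_of_forall_mem hU.measurableSet hvw)

theorem IsTest.integral_fderiv_eq_zero {ψ : Vec d → ℝ} (hψ : IsTest Ω ψ) (j : Fin d) :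
    ∫ x in Ω, fderiv ℝ ψ x (unitVec j) = 0 := by
  simpa [grad, unitVec] using
    (hasWeakGrad_grad (contDiff_const (c := unitVec j))).2.2 ψ hψ j j

theorem IsTest.integral_grad_eq_zero (hv : IsTest Ω v) (p : Fin d × Fin d) :
    ∫ x in Ω, grad v x p = 0 := by
  simpa only [fderiv_apply_unitVec (hv.1.differentiable (by simp) _)] using
    (hv.apply p.1).integral_fderiv_eq_zero p.2

theorem IsTest.integrable_grad (hv : IsTest Ω v) : Integrable (grad v) := by
  refine (continuous_grad hv.1).integrable_of_hasCompactSupport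
    ((hv.2.1.fderiv ℝ).mono fun x hx h0 => hx ?_)
  ext p
  simp [grad, h0]

theorem HasZeroTrace.integral_eq_zero (h : HasZeroTrace Ω v G) (hG : IntegrableOn G Ω)
    (p : Fin d × Fin d) : ∫ x in Ω, G x p = 0 := by
  let coord : Mat d →L[ℝ] ℝ := EuclideanSpace.proj (𝕜 := ℝ) p
  rw [← norm_le_zero_iff]
  refine le_of_forall_pos_le_add fun ε hε => ?_
  obtain ⟨ψ, hψ, hlt⟩ := h (ENNReal.ofReal ε) (ENNReal.ofReal_pos.2 hε)
  have hsub : ∫ x in Ω, G x p = ∫ x in Ω, coord (G x - grad ψ x) := by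
    simp only [map_sub]
    rw [integral_sub (coord.integrable_comp hG)
      (coord.integrable_comp hψ.integrable_grad.integrableOn)]
    exact (sub_eq_self.2 (hψ.integral_grad_eq_zero p)).symm
  rw [hsub, zero_add]
  refine (norm_integral_le_lintegral_norm _).trans (ENNReal.toReal_le_of_le_ofReal hε.le ?_)
  calc ∫⁻ x in Ω, ENNReal.ofReal ‖coord (G x - grad ψ x)‖
      ≤ ∫⁻ x in Ω, ‖G x - grad ψ x‖ₑ := lintegral_mono fun x => by
        rw [ofReal_norm]
        exact enorm_le_iff_norm_le.2 (PiLp.norm_apply_le (G x - grad ψ x) p)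
    _ = eLpNorm (fun x => G x - grad ψ x) 1 (volume.restrict Ω) :=
        eLpNorm_one_eq_lintegral_enorm.symm
    _ ≤ ENNReal.ofReal ε := le_add_self.trans hlt.le

theorem integral_weakDiv_eq_zero (hΩ : IsOpen Ω) (hΩvol : volume Ω ≠ ⊤) (hv : v ∈ W01Infty Ω) :
    ∫ x in Ω, weakDiv Ω v x = 0 := by
  obtain ⟨G, hG, -, hGtop, htrace⟩ := hv
  have : IsFiniteMeasure (volume.restrict Ω) := isFiniteMeasure_restrict.2 hΩvol
  have hGint : IntegrableOn G Ω := hGtop.integrable le_top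
  have hdiv : weakDiv Ω v =ᵐ[volume.restrict Ω] fun x => ∑ i, G x (i, i) := by
    filter_upwards [hG.weakGrad_ae_eq hΩ] with x hx
    rw [weakDiv, hx, tr]
  rw [integral_congr_ae hdiv, integral_finsetSum]
  · exact Finset.sum_eq_zero fun i _ => htrace.integral_eq_zero hGint (i, i)
  · exact fun i _ => (EuclideanSpace.proj (𝕜 := ℝ) (i, i) : Mat d →L[ℝ] ℝ).integrable_comp hGint

theorem symPart_sub (P Q : Mat d) : symPart (P - Q) = symPart P - symPart Q := by
  ext p
  simp only [symPart, PiLp.sub_apply]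
  ring

theorem continuous_symPart : Continuous (symPart (d := d)) := by
  unfold symPart
  fun_prop

theorem norm_symPart_le (Q : Mat d) : ‖symPart Q‖ ≤ ‖Q‖ := by
  let Qt : Mat d := WithLp.toLp 2 fun p => Q (p.2, p.1)
  have htranspose : ‖Qt‖ = ‖Q‖ := by
    rw [EuclideanSpace.norm_eq, EuclideanSpace.norm_eq]
    exact congrArg _ ((Equiv.prodComm (Fin d) (Fin d)).sum_comp fun p => ‖Q p‖ ^ 2)
  have hsym : symPart Q = (2⁻¹ : ℝ) • (Q + Qt) := by
    ext p
    simp only [symPart, Qt, PiLp.smul_apply, PiLp.add_apply, smul_eq_mul]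
    ring
  calc ‖symPart Q‖ = 2⁻¹ * ‖Q + Qt‖ := by rw [hsym, norm_smul]; norm_num
    _ ≤ 2⁻¹ * (‖Q‖ + ‖Qt‖) := by gcongr; exact norm_add_le _ _
    _ = ‖Q‖ := by rw [htranspose]; ring

theorem memLPhi_symGrad {φ : ℝ → ℝ} (hφ : IsNFunction φ) (hΩ : IsOpen Ω) (hv : v ∈ W01Phi φ Ω) :
    MemLPhi φ Ω (symGrad Ω v) := by
  obtain ⟨G, hG, -, hGφ, -⟩ := hv
  have hae := hG.weakGrad_ae_eq hΩ
  refine hGφ.mono hφ (continuous_symPart.comp_aestronglyMeasurable (hGφ.1.congr hae.symm)) ?_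
  filter_upwards [hae] with x hx
  rw [symGrad, hx]
  exact norm_symPart_le _

theorem symGrad_sub_ae_eq (hΩ : IsOpen Ω) (hv : HasWeakGrad Ω v G) (hw : HasWeakGrad Ω w H) :
    symGrad Ω (v - w) =ᵐ[volume.restrict Ω] fun x => symGrad Ω v x - symGrad Ω w x := by
  have hsub := hv.weakGrad.add (hw.weakGrad.const_smul (-1))
  rw [neg_one_smul, neg_one_smul, ← sub_eq_add_neg, ← sub_eq_add_neg] at hsub
  filter_upwards [hsub.weakGrad_ae_eq hΩ] with x hx
  rw [symGrad, hx, Pi.sub_apply, symPart_sub, symGrad, symGrad]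

end WeakGrad

/-! ### Piecewise constant functions on a mesh -/

theorem interior_hull_eq_empty {d : ℕ} {s : Finset (Vec d)} (hs : s.card ≤ d) :
    interior (hull s) = ∅ := by
  by_contra hne
  have hspan := interior_convexHull_nonempty_iff_affineSpan_eq_top.1 (nonempty_iff_ne_empty.2 hne)
  have hs0 : s.Nonempty := by
    rw [Finset.nonempty_iff_ne_empty]
    rintro rfl
    simp [hull] at hne
  obtain ⟨n, hn⟩ := Nat.exists_eq_succ_of_ne_zero hs0.card_ne_zero
  have hrank := finrank_vectorSpan_image_finset_le ℝ (id : Vec d → Vec d) s hn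
  rw [Finset.image_id, ← direction_affineSpan, hspan, AffineSubspace.direction_top,
    finrank_top, finrank_euclideanSpace_fin] at hrank
  omega

namespace Mesh

section Piecewise

variable {d : ℕ} {T : Mesh d} {Ω : Set (Vec d)}

theorem mem_faces (K : T.elements) : K.1 ∈ T.complex.faces := by
  simpa using (Finset.mem_filter.1 K.2).1

theorem card_eq (K : T.elements) : K.1.card = d + 1 := (Finset.mem_filter.1 K.2).2

theorem interior_hull_nonempty (K : T.elements) : (interior (hull K.1)).Nonempty := by
  rw [hull, interior_convexHull_nonempty_iff_affineSpan_eq_top]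
  have htot := (T.elementBasis K).tot
  have hrange : range (T.elementBasis K) = (K.1 : Set (Vec d)) := Subtype.range_coe
  rwa [hrange] at htot

theorem disjoint_interior_hull {K L : T.elements} (hKL : K ≠ L) :
    Disjoint (interior (hull K.1)) (interior (hull L.1)) := by
  classical
  have hsub : hull K.1 ∩ hull L.1 ⊆ hull (K.1 ∩ L.1) := by
    rw [hull, hull, hull, Finset.coe_inter]
    exact T.complex.inter_subset_convexHull (mem_faces K) (mem_faces L)
  have hssub : K.1 ∩ L.1 ⊂ K.1 := by
    refine Finset.ssubset_iff_subset_ne.2 ⟨Finset.inter_subset_left, fun h => hKL ?_⟩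
    exact Subtype.ext (Finset.eq_of_subset_of_card_le (Finset.inter_eq_left.1 h)
      ((card_eq L).trans (card_eq K).symm).le)
  have hcard : (K.1 ∩ L.1).card ≤ d :=
    Nat.le_of_lt_succ ((Finset.card_lt_card hssub).trans_eq (card_eq K))
  rw [disjoint_iff_inter_eq_empty, ← interior_inter, ← subset_empty_iff,
    ← interior_hull_eq_empty hcard]
  exact interior_mono hsub

theorem pw_eq (g : T.elements → ℝ) {K : T.elements} {x : Vec d} (hx : x ∈ interior (hull K.1)) :
    T.pw g x = g K := by
  rw [pw, Finset.sum_eq_single_of_mem K (Finset.mem_univ K) fun L _ hL => ?_,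
    indicator_of_mem hx]
  exact indicator_of_notMem (disjoint_left.1 (disjoint_interior_hull hL.symm) hx) _

theorem pw_zero : T.pw 0 = 0 := by
  funext x
  simp [pw]

theorem pw_mul_pw (g h : T.elements → ℝ) (x : Vec d) : T.pw g x * T.pw h x = T.pw (g * h) x := by
  by_cases hx : ∃ K : T.elements, x ∈ interior (hull K.1)
  · obtain ⟨K, hK⟩ := hx
    simp only [pw_eq _ hK, Pi.mul_apply]
  · push Not at hx
    simp [pw, hx]

theorem setIntegral_pw (hΩ : volume Ω ≠ ⊤) (g : T.elements → ℝ) :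
    ∫ x in Ω, T.pw g x = ∑ K, (volume.restrict Ω).real (interior (hull K.1)) * g K := by
  have : IsFiniteMeasure (volume.restrict Ω) := isFiniteMeasure_restrict.2 hΩ
  simp only [pw]
  rw [integral_finsetSum _ fun K _ =>
    (integrable_const (g K)).indicator isOpen_interior.measurableSet]
  simp only [integral_indicator_const _ isOpen_interior.measurableSet, smul_eq_mul]

theorem IsMeshOf.measureReal_interior_hull_pos (hT : T.IsMeshOf Ω) (K : T.elements) :
    0 < (volume.restrict Ω).real (interior (hull K.1)) := by
  have : IsFiniteMeasure (volume.restrict Ω) :=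
    isFiniteMeasure_restrict.2 hT.isBounded.measure_lt_top.ne
  obtain ⟨x, hx⟩ := interior_hull_nonempty K
  have hxΩ : x ∈ closure Ω := by
    rw [hT.closure_eq]
    exact mem_iUnion₂.2 ⟨K.1, K.2, interior_subset hx⟩
  refine ENNReal.toReal_pos ?_ (measure_ne_top _ _)
  rw [Measure.restrict_apply isOpen_interior.measurableSet]
  exact ((isOpen_interior.inter hT.isOpen).measure_pos volume
    (mem_closure_iff.1 hxΩ _ isOpen_interior hx)).ne'

theorem IsMeshOf.eq_zero_of_setIntegral_pw_mul_self (hT : T.IsMeshOf Ω) {g : T.elements → ℝ}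
    (hg : ∫ x in Ω, T.pw g x * T.pw g x = 0) : g = 0 := by
  simp only [pw_mul_pw, setIntegral_pw hT.isBounded.measure_lt_top.ne, Pi.mul_apply] at hg
  rw [Finset.sum_eq_zero_iff_of_nonneg fun K _ =>
    mul_nonneg measureReal_nonneg (mul_self_nonneg _)] at hg
  funext K
  exact mul_self_eq_zero.1 <|
    (mul_eq_zero.1 (hg K (Finset.mem_univ K))).resolve_left (hT.measureReal_interior_hull_pos K).ne'

end Piecewise

end Mesh

/-! ### Divergence preservation -/

theorem contDiff_mvPolynomial_eval {d : ℕ} (P : MvPolynomial (Fin d) ℝ) :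
    ContDiff ℝ ∞ fun x : Vec d => MvPolynomial.eval (fun j => x j) P := by
  induction P using MvPolynomial.induction_on with
  | C a => simpa only [MvPolynomial.eval_C] using contDiff_const
  | add p q hp hq => simpa only [map_add] using hp.add hq
  | mul_X p i hp =>
    simpa using hp.mul (EuclideanSpace.proj (𝕜 := ℝ) i : Vec d →L[ℝ] ℝ).contDiff

theorem grad_eq_of_eqOn {d : ℕ} {U : Set (Vec d)} {v w : Vec d → Vec d} (hU : IsOpen U)
    (h : EqOn v w U) {x : Vec d} (hx : x ∈ U) : grad v x = grad w x := by
  rw [grad, grad, (h.eventuallyEq_of_mem (hU.mem_nhds hx)).fderiv_eq]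

theorem tr_add {d : ℕ} (P Q : Mat d) : tr (P + Q) = tr P + tr Q := by
  simp only [tr, PiLp.add_apply, Finset.sum_add_distrib]

namespace Mesh

section Smoothing

variable {d : ℕ} {T : Mesh d} {Ω : Set (Vec d)}

theorem contDiff_bary (K : T.elements) (z : Vec d) : ContDiff ℝ ∞ (T.bary K z) :=
  (⟨T.bary K z, (T.bary K z).continuous_of_finiteDimensional⟩ : Vec d →ᴬ[ℝ] ℝ).contDiff

theorem contDiff_averaging_add_faceCorrection (α : Vec d → T.elements → ℝ) (v : T.BrokenP1)
    (K : T.elements) :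
    ContDiff ℝ ∞ fun x => T.averaging Ω α v K x + T.faceCorrection Ω α v K x :=
  (ContDiff.sum fun z _ => (contDiff_bary K z).smul contDiff_const).add <|
    ContDiff.sum fun _ _ => (contDiff_prod fun z _ => contDiff_bary K z).smul contDiff_const

theorem IsElementBubble.exists_contDiff_eqOn {K : T.elements} {w : Vec d → Vec d}
    (hw : T.IsElementBubble K w) {z : Vec d} (hz : z ∈ K.1) :
    ∃ q : Vec d → Vec d, ContDiff ℝ ∞ q ∧ EqOn w q (T.subElement K z) := by
  choose P hP using hw.2.2 z hz
  refine ⟨fun x => WithLp.toLp 2 fun i => MvPolynomial.eval (fun j => x j) (P i),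
    contDiff_euclidean.2 fun i => contDiff_mvPolynomial_eval (P i), fun x hx => ?_⟩
  ext i
  exact hP i x hx

theorem convex_subElement (K : T.elements) (z : Vec d) : Convex ℝ (T.subElement K z) := by
  have hinter : T.subElement K z =
      hull K.1 ∩ ⋂ y ∈ K.1, (T.bary K y - T.bary K z) ⁻¹' Ici (0 : ℝ) := by
    ext x
    simp [subElement]
  rw [hinter]
  exact (convex_convexHull ℝ _).inter
    (convex_iInter₂ fun y _ => (convex_Ici 0).affine_preimage _)

theorem exists_mem_subElement {K : T.elements} {x : Vec d} (hx : x ∈ hull K.1) :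
    ∃ z ∈ K.1, x ∈ T.subElement K z := by
  have hne : K.1.Nonempty := Finset.card_ne_zero.1 (by rw [card_eq]; exact d.succ_ne_zero)
  obtain ⟨z, hz, hmin⟩ := K.1.exists_min_image (fun z => T.bary K z x) hne
  exact ⟨z, hz, hx, hmin⟩

theorem IsMeshOf.ae_mem_interior_subElement (hT : T.IsMeshOf Ω) :
    ∀ᵐ x, x ∈ Ω → ∃ K : T.elements, ∃ z : K.1, x ∈ interior (T.subElement K z) := by
  have hnull : ∀ᵐ x : Vec d, ∀ K : T.elements, ∀ z : K.1, x ∉ frontier (T.subElement K z) :=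
    ae_all_iff.2 fun K => ae_all_iff.2 fun z =>
      measure_eq_zero_iff_ae_notMem.1 ((convex_subElement K z).addHaar_frontier volume)
  filter_upwards [hnull] with x hx hxΩ
  have hcover : x ∈ ⋃ K ∈ T.elements, hull K := hT.closure_eq ▸ subset_closure hxΩ
  obtain ⟨K, hK, hxK⟩ := mem_iUnion₂.1 hcover
  obtain ⟨z, hz, hxz⟩ := exists_mem_subElement (K := ⟨K, hK⟩) hxK
  refine ⟨⟨K, hK⟩, ⟨z, hz⟩, ?_⟩
  by_contra hni
  exact hx ⟨K, hK⟩ ⟨z, hz⟩ ⟨subset_closure hxz, hni⟩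

/-- `E` preserves the divergence: the weak divergence of `Ev` is the element-wise divergence
of `v`. This is the only property of the smoothing operator that the error analysis uses. -/
def PreservesDiv (T : Mesh d) (Ω : Set (Vec d)) (E : T.CR Ω →ₗ[ℝ] W01Infty Ω) : Prop :=
  ∀ v : T.CR Ω, weakDiv Ω (E v).1 =ᵐ[volume.restrict Ω] T.pw (T.divh v.1)

theorem IsElementCorrection.weakDiv_ae_eq {α : Vec d → T.elements → ℝ} {v : T.BrokenP1}
    {K : T.elements} {w y : Vec d → Vec d} {G : Vec d → Mat d}
    (hw : T.IsElementCorrection Ω α v K w) (hΩ : IsOpen Ω) (hG : HasWeakGrad Ω y G)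
    (hy : ∀ x ∈ hull K.1, y x = T.averaging Ω α v K x + T.faceCorrection Ω α v K x + w x)
    (z : K.1) :
    ∀ᵐ x, x ∈ Ω ∩ interior (T.subElement K z) → weakDiv Ω y x = T.divh v K := by
  set s : Vec d → Vec d := fun x => T.averaging Ω α v K x + T.faceCorrection Ω α v K x
  have hs : ContDiff ℝ ∞ s := contDiff_averaging_add_faceCorrection α v K
  obtain ⟨q, hq, hwq⟩ := hw.isElementBubble.exists_contDiff_eqOn z.2
  have hopen : IsOpen (Ω ∩ interior (T.subElement K z)) := hΩ.inter isOpen_interior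
  have hysq : EqOn y (s + q) (Ω ∩ interior (T.subElement K z)) := fun x hx => by
    have hx' := interior_subset hx.2
    rw [hy x hx'.1, hwq hx', Pi.add_apply]
  have hsq : ContDiff ℝ ∞ (s + q) := hs.add hq
  have hgrad := (ae_restrict_iff' hopen.measurableSet).1 <|
    hG.weakGrad_ae_eq_grad hopen inter_subset_left hsq hysq
  filter_upwards [hgrad] with x hx hxU
  have hdiv : tr (grad w x) = T.divh v K - tr (grad s x) := hw.div_eq z z.2 x hxU.2
  rw [grad_eq_of_eqOn isOpen_interior (hwq.mono interior_subset) hxU.2] at hdiv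
  rw [weakDiv, hx hxU, grad_add (hs.differentiable (by simp)) (hq.differentiable (by simp)),
    Pi.add_apply, tr_add, hdiv, add_sub_cancel]

theorem IsSmoothingOperator.preservesDiv {E : T.CR Ω →ₗ[ℝ] W01Infty Ω}
    (hE : T.IsSmoothingOperator Ω E) (hT : T.IsMeshOf Ω) : T.PreservesDiv Ω E := by
  obtain ⟨α, -, hE⟩ := hE
  intro v
  obtain ⟨G, hG, -⟩ := (E v).2
  have hlocal : ∀ K : T.elements, ∀ z : K.1, ∀ᵐ x, x ∈ Ω ∩ interior (T.subElement K z) →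
      weakDiv Ω (E v).1 x = T.divh v.1 K := fun K z => by
    obtain ⟨w, hw, hEv⟩ := hE v K
    exact hw.weakDiv_ae_eq hT.isOpen hG hEv z
  refine (ae_restrict_iff' hT.isOpen.measurableSet).2 ?_
  filter_upwards [hT.ae_mem_interior_subElement,
    ae_all_iff.2 fun K => ae_all_iff.2 (hlocal K)] with x hx hdiv hxΩ
  obtain ⟨K, z, hxz⟩ := hx hxΩ
  rw [hdiv K z ⟨hxΩ, hxz⟩, pw_eq _ (interior_mono (sep_subset _ _) hxz)]

theorem PreservesDiv.mem_Zh {E : T.CR Ω →ₗ[ℝ] W01Infty Ω} (hE : T.PreservesDiv Ω E)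
    (hT : T.IsMeshOf Ω) {v : T.CR Ω}
    (hv : ∀ q ∈ T.S00hat Ω, ∫ x in Ω, T.pw q x * T.pw (T.divh v.1) x = 0) : v ∈ T.Zh Ω := by
  have hmean : T.divh v.1 ∈ T.S00hat Ω :=
    (integral_congr_ae (hE v)).symm.trans <|
      integral_weakDiv_eq_zero hT.isOpen hT.isBounded.measure_lt_top.ne (E v).2
  exact congrFun (hT.eq_zero_of_setIntegral_pw_mul_self (hv _ hmean))

theorem sub_mem_Zh {v w : T.CR Ω} (hv : v ∈ T.Zh Ω) (hw : w ∈ T.Zh Ω) :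
    v - w ∈ T.Zh Ω := fun K => by
  have hdivh : T.divh (v - w).1 K = T.divh v.1 K - T.divh w.1 K := by
    simp [divh, Finset.sum_sub_distrib]
  rw [hdivh, hv K, hw K, sub_zero]

end Smoothing

end Mesh

/-! ### Quasi-optimality -/

theorem exists_isNaturalMap.{u} (a b c₀ c₁ : ℝ) :
    ∃ K₁ K₂ : ℝ, ∀ (V : Type u) [NormedAddCommGroup V] [InnerProductSpace ℝ V] (h : ℝ → ℝ)
      (A : V → V), IsPowerLike h a b → HasStructure h c₀ c₁ A →
        IsNaturalMap A (radial fun t => √(h t * t)) K₁ K₂ := by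
  let k := c₀ * a * (4 ^ b)⁻¹ / 4
  let K := 4 * c₁ * (b + 2)
  let l := 1 + 2 * K / k
  let a' := (a + 1) / 2
  let b' := (b + 1) / 2
  let kF := min 1 b'⁻¹ * a' * (4 ^ b')⁻¹ / 4
  let KF := 4 * (2 * a'⁻¹ + 1) * (b' + 2)
  refine ⟨KF ^ 2 / k, k * l / 2 * (3 * l * (3 * l) ^ b) / kF ^ 2, fun V _ _ h A H hA => ?_⟩
  have hAmon : IsWeightedMonotone h k K A := hA.isWeightedMonotone H
  have hFmon : IsWeightedMonotone (fun t => √(h t * t)) kF KF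
      (radial fun t => √(h t * t) : V → V) :=
    (hasStructure_radial H.sqrt_mul_id).isWeightedMonotone H.sqrt_mul_id
  have hk : 0 < k := hAmon.k_pos
  have hK : 0 ≤ K := mul_nonneg (by linarith [hA.c₁_nonneg]) (by linarith [H.b_pos])
  have hkl : k * l = k + 2 * K := by
    rw [mul_add, mul_div_cancel₀ _ hk.ne', mul_one]
  exact hAmon.isNaturalMap H hFmon (le_add_of_nonneg_right (by positivity)) (by linarith)

section Scheme

variable {d : ℕ} {φ : ℝ → ℝ} {rm rp c₀ c₁ : ℝ} {A : Mat d → Mat d} {Ω : Set (Vec d)} {T : Mesh d}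
  {E : T.CR Ω →ₗ[ℝ] W01Infty Ω} {f : (Vec d → Vec d) → ℝ} {u : Vec d → Vec d} {p : Vec d → ℝ}
  {uh vh : T.CR Ω} {ph : T.elements → ℝ}

theorem Mesh.PreservesDiv.weakDiv_ae_eq_zero (hE : T.PreservesDiv Ω E) (hv : vh ∈ T.Zh Ω) :
    weakDiv Ω (E vh).1 =ᵐ[volume.restrict Ω] 0 := by
  have hdivh : T.divh vh.1 = 0 := funext hv
  simpa only [hdivh, Mesh.pw_zero] using hE vh

theorem galerkin_orthogonality (hφ : IsUniformlyConvexNFunction φ rm rp)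
    (hA : HasStructure (deriv φ) c₀ c₁ A) (hT : T.IsMeshOf Ω) (hE : T.PreservesDiv Ω E)
    (hu : IsWeakSolution φ A Ω f u p) (huh : T.IsDiscreteSolution Ω A E f uh ph)
    (hv : vh ∈ T.Zh Ω) :
    ∫ x in Ω,
      inner ℝ (A (symGrad Ω u x) - A (symGrad Ω (E uh).1 x)) (symGrad Ω (E vh).1 x) = 0 := by
  have hmem : ∀ w : W01Infty Ω, w.1 ∈ W01Phi φ Ω := fun w =>
    W01Infty_subset_W01Phi hφ.isNFunction hT.isBounded.measure_lt_top.ne w.2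
  have hD : ∀ {w}, w ∈ W01Phi φ Ω → MemLPhi φ Ω (symGrad Ω w) :=
    memLPhi_symGrad hφ.isNFunction hT.isOpen
  have hpressure : ∫ x in Ω, p x * weakDiv Ω (E vh).1 x = 0 := by
    refine integral_eq_zero_of_ae ?_
    filter_upwards [hE.weakDiv_ae_eq_zero hv] with x hx
    rw [hx, Pi.zero_apply, mul_zero]
  have hpressureh : ∫ x in Ω, T.pw ph x * T.pw (T.divh vh.1) x = 0 := by
    have hdivh : T.divh vh.1 = 0 := funext hv
    simp [hdivh, Mesh.pw_zero]
  have hmom := hu.momentum _ (hmem (E vh))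
  have hmomh := huh.momentum vh
  rw [hpressure, sub_zero] at hmom
  rw [hpressureh, sub_zero] at hmomh
  simp only [inner_sub_left]
  rw [integral_sub (hA.integrable_inner hφ (hD hu.velocity_mem) (hD (hmem _)))
    (hA.integrable_inner hφ (hD (hmem _)) (hD (hmem _))), hmom, hmomh, sub_self]

theorem IsNaturalMap.natDist_le {K₁ K₂ : ℝ} (hAF : IsNaturalMap A (natF φ) K₁ K₂)
    (hφ : IsUniformlyConvexNFunction φ rm rp) (hA : HasStructure (deriv φ) c₀ c₁ A)
    (hT : T.IsMeshOf Ω) (hE : T.PreservesDiv Ω E) (hu : IsWeakSolution φ A Ω f u p)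
    (huh : T.IsDiscreteSolution Ω A E f uh ph) (hv : vh ∈ T.Zh Ω) :
    natDist φ Ω u (E uh).1 ≤ ENNReal.ofReal √(K₁ * (2 * K₂)) * natDist φ Ω u (E vh).1 := by
  have hD : ∀ {w}, w ∈ W01Phi φ Ω → MemLPhi φ Ω (symGrad Ω w) :=
    memLPhi_symGrad hφ.isNFunction hT.isOpen
  have hDE : ∀ w, MemLPhi φ Ω (symGrad Ω (E w).1) := fun w =>
    hD (W01Infty_subset_W01Phi hφ.isNFunction hT.isBounded.measure_lt_top.ne (E w).2)
  have hDu := hD hu.velocity_mem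
  have hdiff : uh - vh ∈ T.Zh Ω := Mesh.sub_mem_Zh (hE.mem_Zh hT huh.mass) hv
  obtain ⟨G, hG, -⟩ := (E uh).2
  obtain ⟨H, hH, -⟩ := (E vh).2
  refine hAF.eLpNorm_sub_le (hA.integrable_inner_sub_sub hφ hDu (hDE uh) hDu (hDE uh))
    (hA.integrable_inner_sub_sub hφ hDu (hDE uh) hDu (hDE vh))
    ((memLp_natF hφ hDu).sub (memLp_natF hφ (hDE uh)))
    ((memLp_natF hφ hDu).sub (memLp_natF hφ (hDE vh))) ?_
  rw [← galerkin_orthogonality hφ hA hT hE hu huh hdiff, map_sub]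
  refine integral_congr_ae ?_
  filter_upwards [symGrad_sub_ae_eq hT.isOpen hG hH] with x hx
  exact congrArg (inner ℝ _) hx.symm

end Scheme

end NonlinearStokes

end

open NonlinearStokes in
theorem theorem4p3_general (n : ℕ) (rm rp C₀ C₁ : ℝ) :
    ∃ c : ℝ≥0, ∀ d ≤ n, ∀ φ : ℝ → ℝ, IsUniformlyConvexNFunction φ rm rp →
      ∀ A : Mat d → Mat d, HasPhiStructure φ C₀ C₁ A →
      ∀ (Ω : Set (Vec d)) (T : Mesh d), T.IsMeshOf Ω →
      ∀ E : T.CR Ω →ₗ[ℝ] W01Infty Ω, T.PreservesDiv Ω E →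
      ∀ (f : (Vec d → Vec d) → ℝ) (u : Vec d → Vec d) (p : Vec d → ℝ),
        IsWeakSolution φ A Ω f u p →
      ∀ (uh : T.CR Ω) (ph : T.elements → ℝ), T.IsDiscreteSolution Ω A E f uh ph →
        natDist φ Ω u (E uh).1 ≤ c * ⨅ vh ∈ T.Zh Ω, natDist φ Ω u (E vh).1 := by
  obtain ⟨K₁, K₂, hnat⟩ := exists_isNaturalMap (rm - 1) (rp - 1) C₀ (n ^ 2 * C₁)
  refine ⟨(√(K₁ * (2 * K₂))).toNNReal, fun d hd φ hφ A hA Ω T hT E hE f u p hu uh ph huh => ?_⟩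
  have H : IsPowerLike (deriv φ) (rm - 1) (rp - 1) := hφ.isPowerLike
  have hd2 : (d : ℝ) ^ 2 * C₁ ≤ n ^ 2 * C₁ := by
    have := hA.C₁_pos
    gcongr
  have hA' : HasStructure (deriv φ) C₀ (n ^ 2 * C₁) A := (hA.hasStructure H).mono H hd2
  have : Nonempty (T.Zh Ω) := ⟨⟨uh, hE.mem_Zh hT huh.mass⟩⟩
  rw [iInf_subtype', ENNReal.mul_iInf fun h => absurd h ENNReal.coe_ne_top]
  exact le_iInf fun vh =>
    (hnat (Mat d) (deriv φ) A H hA').natDist_le hφ hA' hT hE hu huh vh.2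

theorem theorem4p3 (rm rp C₀ C₁ : ℝ) :
    ∃ c : ℝ≥0, ∀ (d : ℕ), d = 2 ∨ d = 3 →
      ∀ (φ : ℝ → ℝ), NonlinearStokes.IsUniformlyConvexNFunction φ rm rp →
      ∀ (A : NonlinearStokes.Mat d → NonlinearStokes.Mat d),
        NonlinearStokes.HasPhiStructure φ C₀ C₁ A →
      ∀ (Ω : Set (NonlinearStokes.Vec d)) (T : NonlinearStokes.Mesh d), T.IsMeshOf Ω →
      ∀ (E : T.CR Ω →ₗ[ℝ] NonlinearStokes.W01Infty Ω),
        T.IsSmoothingOperator Ω E →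
      ∀ (f : (NonlinearStokes.Vec d → NonlinearStokes.Vec d) → ℝ),
        NonlinearStokes.IsDualFunctional φ Ω f →
      ∀ (u : NonlinearStokes.Vec d → NonlinearStokes.Vec d) (p : NonlinearStokes.Vec d → ℝ),
        NonlinearStokes.IsWeakSolution φ A Ω f u p →
      ∀ (uh : T.CR Ω) (ph : T.elements → ℝ), T.IsDiscreteSolution Ω A E f uh ph →
        NonlinearStokes.natDist φ Ω u (E uh).1 ≤
          c * ⨅ vh ∈ T.Zh Ω, NonlinearStokes.natDist φ Ω u (E vh).1 :=
  (theorem4p3_general 3 rm rp C₀ C₁).imp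
    fun _ hc d hd φ hφ A hA Ω T hT E hE f _ =>
      hc d (by omega) φ hφ A hA Ω T hT E (hE.preservesDiv hT) f
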